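/- Let $d\ge 1$ and let $\mathbb{T}^d=\mathbb{R}^d/\mathbb{Z}^d$ carry its flat Euclidean metric and normalized Lebesgue measure. There exist smooth real radial functions $m$ on $\mathbb{R}^d$ with $m(\xi)=0$ for $|\xi|\ge 1/2$ and $\int_{\mathbb{R}^d} m(\xi)^2\,d\xi=1$. For every such $m$, put $$\widehat K(\xi)=\left(1+|\xi|^2\right)^{-(d+1)/2}(m*m)(\xi),\qquad K(x)=\int_{\mathbb{R}^d}\widehat K(\xi)\,e^{2\pi i\xi\cdot x}\,d\xi .$$ Then there exists a positive function $\psi$ on $[0,\infty)$ with fast decay at infinity (for every real $\alpha$ there is $c(\alpha)$ with $\psi(t)\le c(\alpha)(1+t)^{-\alpha}$ for all $t\ge 0$), depending only on $d$ and $m$, such that for every measurable set $\Omega\subseteq\mathbb{T}^d$ and every integer $R\ge 0$ there exist real trigonometric polynomials $A$ and $B$ of degree at most $R$ (that is, finite sums $\sum_{k\in\mathbb{Z}^d,\ |k|\le R}c_k e^{2\pi i k\cdot x}$, with $|k|$ the Euclidean norm) with, for every $x\in\mathbb{T}^d$, $$A(x)\le\chi_\Omega(x)\le B(x),\qquad |B(x)-A(x)|\le\psi\bigl(R\,\mathrm{dist}(x,\partial\Omega)\bigr),$$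 where $\mathrm{dist}(x,\emptyset)=\infty$, $0\cdot\infty=0$ and $\psi(\infty)=0$. Moreover, if $R\ge 1$, the Fourier coefficients of $A$ and $B$ are, for every $k\in\mathbb{Z}^d$, $$\widehat A(k)=\widehat K(k/R)\bigl(\widehat\chi_\Omega(k)-\widehat H_R(k)\bigr),\qquad \widehat B(k)=\widehat K(k/R)\bigl(\widehat\chi_\Omega(k)+\widehat H_R(k)\bigr),$$ where $$H_R(x)=e^{2\pi}\left(\int_{\{|y|\le 1\}}K(y)\,dy\right)^{-1}\int_{\{|y|\ge R\,\mathrm{dist}(x,\partial\Omega)\}}K(y)\,dy .$$ -/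

import Mathlib

open MeasureTheory
open scoped ENNReal FourierTransform ContDiff Convolution

noncomputable section

namespace TrigApprox

/-- A smooth real-valued radial function `m` on `ℝ^d` that vanishes for `|ξ| ≥ 1/2` and satisfies
`∫ m(ξ)² dξ = 1`. -/
structure IsWindow {d : ℕ} (m : EuclideanSpace ℝ (Fin d) → ℝ) : Prop where
  smooth : ContDiff ℝ ∞ m
  radial : ∀ ξ η : EuclideanSpace ℝ (Fin d), ‖ξ‖ = ‖η‖ → m ξ = m η
  vanish : ∀ ξ : EuclideanSpace ℝ (Fin d), 1 / 2 ≤ ‖ξ‖ → m ξ = 0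
  norm_sq : ∫ ξ, m ξ ^ 2 = 1

/-- `K̂(ξ) = (1 + |ξ|²)^{-(d+1)/2} (m ∗ m)(ξ)`. -/
def kernelHat {d : ℕ} (m : EuclideanSpace ℝ (Fin d) → ℝ) (ξ : EuclideanSpace ℝ (Fin d)) : ℝ :=
  (1 + ‖ξ‖ ^ 2) ^ (-((d : ℝ) + 1) / 2) * (m ⋆[ContinuousLinearMap.mul ℝ ℝ, volume] m) ξ

/-- `K(x) = ∫ K̂(ξ) exp(2πi ξ·x) dξ`. For radial `m` the integral is real, `K̂` being real and
even, so taking the real part only changes the codomain. -/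
def kernel {d : ℕ} (m : EuclideanSpace ℝ (Fin d) → ℝ) (x : EuclideanSpace ℝ (Fin d)) : ℝ :=
  (𝓕⁻ (fun ξ : EuclideanSpace ℝ (Fin d) => (kernelHat m ξ : ℂ)) x).re

/-- The distance, with values in `[0, ∞]`, of a point of the torus `ℝ^d / ℤ^d` from a set, for the
flat (Euclidean) metric of the torus; the distance from the empty set is `∞`. The torus itself
carries the sup metric in Mathlib, so the `ℓ²` product of the circles is used. -/
def torusInfEDist {d : ℕ} (x : UnitAddTorus (Fin d)) (S : Set (UnitAddTorus (Fin d))) : ℝ≥0∞ :=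
  Metric.infEDist (WithLp.toLp 2 x : PiLp 2 (fun _ : Fin d => UnitAddCircle)) (WithLp.toLp 2 '' S)

/-- `H_R(x) = exp(2π) (∫_{|y| ≤ 1} K(y) dy)⁻¹ ∫_{|y| ≥ R dist(x, ∂Ω)} K(y) dy`. -/
def majorant {d : ℕ} (m : EuclideanSpace ℝ (Fin d) → ℝ) (Ω : Set (UnitAddTorus (Fin d))) (R : ℕ)
    (x : UnitAddTorus (Fin d)) : ℝ :=
  Real.exp (2 * Real.pi) * (∫ y in {y : EuclideanSpace ℝ (Fin d) | ‖y‖ ≤ 1}, kernel m y)⁻¹ *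
    ∫ y in {y : EuclideanSpace ℝ (Fin d) | (R : ℝ≥0∞) * torusInfEDist x (frontier Ω) ≤ ‖y‖ₑ},
      kernel m y

/-- The characteristic function of `Ω`. -/
def chi {d : ℕ} (Ω : Set (UnitAddTorus (Fin d))) (x : UnitAddTorus (Fin d)) : ℝ :=
  Ω.indicator (fun _ => (1 : ℝ)) x

/-- The lattice point `k ∈ ℤ^d` as a vector of `ℝ^d` with the Euclidean norm. -/
def latticeVec {d : ℕ} (k : Fin d → ℤ) : EuclideanSpace ℝ (Fin d) :=
  WithLp.toLp 2 (fun i => (k i : ℝ))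

/-- The `k`-th Fourier coefficient `∫ f(x) exp(-2πi k·x) dx` of a real function on the torus. -/
def fourierCoeffReal {d : ℕ} (f : UnitAddTorus (Fin d) → ℝ) (k : Fin d → ℤ) : ℂ :=
  UnitAddTorus.mFourierCoeff (fun x => (f x : ℂ)) k

/-- The real function `f` on the torus is a trigonometric polynomial of degree (at most) `R`: a
finite sum `∑ c_k exp(2πi k·x)` over `k ∈ ℤ^d` with Euclidean norm `|k| ≤ R`. -/
def IsTrigPoly {d : ℕ} (R : ℕ) (f : UnitAddTorus (Fin d) → ℝ) : Prop :=
  ∃ c : (Fin d → ℤ) →₀ ℂ, (∀ k ∈ c.support, ‖latticeVec k‖ ≤ R) ∧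
    ∀ x, (f x : ℂ) = c.sum fun k a => a * UnitAddTorus.mFourier k x

/-- `ψ` is a positive function on `[0, ∞)` with fast decay at infinity. -/
def PosFastDecay (ψ : ℝ → ℝ) : Prop :=
  (∀ t, 0 ≤ t → 0 < ψ t) ∧
    ∀ α : ℝ, ∃ c : ℝ, ∀ t, 0 ≤ t → ψ t ≤ c * (1 + t) ^ (-α)

/-- The value of a function with fast decay at a point of `[0, ∞]`, with `ψ(∞) = 0`. -/
def evalExt (ψ : ℝ → ℝ) (t : ℝ≥0∞) : ℝ :=
  if t = ⊤ then 0 else ψ t.toReal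

end TrigApprox

end

noncomputable section

namespace TrigApprox

variable {d : ℕ}

/-! Smooth `χ_Ω` by convolving it with the periodization of `R^d K(R ·)`. Since `K̂` vanishes
outside the unit ball, every such convolution is a trigonometric polynomial of degree at most `R`.
Since `K ≥ 0` has mass one and a segment from `Ω` to its complement meets `∂Ω`, the error at `x` is
at most `tail(δ)`, the mass of `K` outside the ball of radius `δ = R dist(x, ∂Ω)`
(`abs_chi_sub_smoothing_le`).

The correction `H_R` is a multiple of `tail(δ)` whose own smoothing dominates this error. Averaging
over `|y| ≤ 1` raises the scaled distance by at most one, and `tail(δ) ≤ exp(2π) tail(δ + 1)`; the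
constant in `H_R` pays for this factor and for the mass of the unit ball
(`tail_le_smoothing_majorant`). So the smoothings of `χ_Ω - H_R` and `χ_Ω + H_R` lie below and above
`χ_Ω`. They differ by twice the smoothing of `H_R`, which is a multiple of `tail(δ/2)` at most
(`smoothing_majorant_le`) and decays fast because `K` is a Schwartz function.

The comparison of tails is where the form of `K̂` matters: `(1 + |ξ|²)^{-(d+1)/2}` is a multiple of
the Fourier transform of `exp(-2π|x|)`, and the transform of `m ∗ m` is the square of a real
function. So `K` is a positive measure convolved with `exp(-2π|x|)`, and it inherits positivity and
the Harnack inequality `K(x) ≤ exp(2π|x - x'|) K(x')` (`kernel_le_exp_mul`). -/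

/-! ### Subordination of the Bessel kernel of order `d + 1` to Gaussians -/

/-- The substitution `t ↦ √t - a / √t` maps `(0, ∞)` bijectively onto `ℝ`. -/
def glasserMap (a t : ℝ) : ℝ := √t - a / √t

lemma hasDerivAt_glasserMap (a : ℝ) {t : ℝ} (ht : 0 < t) :
    HasDerivAt (glasserMap a) ((1 / 2) * (1 / √t + a / (t * √t))) t := by
  have hs : 0 < √t := Real.sqrt_pos.2 ht
  have h1 := Real.hasDerivAt_sqrt ht.ne'
  have h2 := h1.sub ((hasDerivAt_const t a).div h1 hs.ne')
  convert! h2 using 1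
  have : t = √t ^ 2 := (Real.sq_sqrt ht.le).symm
  field_simp
  rw [← this]
  ring

lemma glasserMap_sq {a t : ℝ} (ht : 0 < t) : glasserMap a t ^ 2 = t + a ^ 2 / t - 2 * a := by
  have hs : 0 < √t := Real.sqrt_pos.2 ht
  unfold glasserMap
  have h : t = √t ^ 2 := (Real.sq_sqrt ht.le).symm
  rw [sub_sq, div_pow, ← h]
  field_simp
  ring

lemma injOn_glasserMap {a : ℝ} (ha : 0 < a) : Set.InjOn (glasserMap a) (Set.Ioi 0) := by
  refine StrictMonoOn.injOn fun s hs t ht hst => ?_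
  have h1 : 0 < √s := Real.sqrt_pos.2 hs
  have h2 : √s < √t := Real.sqrt_lt_sqrt (le_of_lt hs) hst
  have h3 : a / √t < a / √s := div_lt_div_of_pos_left ha h1 h2
  unfold glasserMap
  linarith

lemma image_glasserMap {a : ℝ} (ha : 0 < a) : glasserMap a '' Set.Ioi 0 = Set.univ := by
  refine Set.eq_univ_of_forall fun w => ?_
  have h0 : |w| < √(w ^ 2 + 4 * a) := by
    rw [← Real.sqrt_sq_eq_abs]
    exact Real.sqrt_lt_sqrt (sq_nonneg w) (by linarith)
  have hr : √(w ^ 2 + 4 * a) ^ 2 = w ^ 2 + 4 * a := Real.sq_sqrt (by positivity)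
  set r := √(w ^ 2 + 4 * a)
  have hs : 0 < (w + r) / 2 := by
    have := neg_abs_le w
    linarith
  -- The witness is the square of the positive root of `s² - w s - a = 0`, where `s = √t`.
  refine ⟨((w + r) / 2) ^ 2, by simp only [Set.mem_Ioi]; positivity, ?_⟩
  unfold glasserMap
  have hne : w + r ≠ 0 := by linarith
  rw [Real.sqrt_sq hs.le]
  field_simp
  nlinarith

/-- Substituting `w = √t - a/√t` in the Gaussian integral gives `w² = t + a²/t - 2a`, and `dw` has
two terms. The involution `t ↦ a²/t` exchanges them, so each carries half of the Gaussian integral.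
-/
lemma integral_inv_sqrt_mul_exp_neg_sub_div {a : ℝ} (ha : 0 ≤ a) :
    ∫ t in Set.Ioi (0 : ℝ), 1 / √t * Real.exp (-t - a ^ 2 / t) = √Real.pi * Real.exp (-2 * a) := by
  rcases ha.eq_or_lt with rfl | ha
  -- For `a = 0` the substitution is not onto `ℝ`, but the integral is `Γ(1/2)`.
  · have h := Real.integral_rpow_mul_exp_neg_mul_Ioi (a := 1 / 2) (r := 1) (by norm_num) one_pos
    rw [Real.Gamma_one_half_eq, div_one, Real.one_rpow, one_mul] at h
    rw [mul_zero, Real.exp_zero, mul_one, ← h]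
    refine setIntegral_congr_fun measurableSet_Ioi fun t (ht : 0 < t) => ?_
    simp only [Real.sqrt_eq_rpow]
    rw [one_div, ← Real.rpow_neg ht.le]
    norm_num
  have hder : ∀ t ∈ Set.Ioi (0 : ℝ), HasDerivWithinAt (glasserMap a)
      ((1 / 2) * (1 / √t + a / (t * √t))) (Set.Ioi 0) t :=
    fun t ht => (hasDerivAt_glasserMap a ht).hasDerivWithinAt
  have hgauss := integral_gaussian 1
  have hint := (integrable_exp_neg_mul_sq (b := 1) one_pos)
  rw [← integrableOn_univ, ← image_glasserMap ha,
    integrableOn_image_iff_integrableOn_abs_deriv_smul measurableSet_Ioi hder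
      (injOn_glasserMap ha)] at hint
  rw [← setIntegral_univ, ← image_glasserMap ha,
    integral_image_eq_integral_abs_deriv_smul measurableSet_Ioi hder (injOn_glasserMap ha),
    div_one] at hgauss
  have hinv : ∀ t ∈ Set.Ioi (0 : ℝ), HasDerivWithinAt (fun t : ℝ => a ^ 2 / t)
      (-(a ^ 2 / t ^ 2)) (Set.Ioi 0) t := by
    intro t ht
    have h := (hasDerivAt_const t (a ^ 2)).div (hasDerivAt_id t) (ne_of_gt ht)
    convert! h.hasDerivWithinAt using 1
    simp [neg_div]
  have hinj : Set.InjOn (fun t : ℝ => a ^ 2 / t) (Set.Ioi 0) := by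
    intro s hs t ht hst
    have hs : 0 < s := hs
    have ht : 0 < t := ht
    simp only at hst
    field_simp at hst
    exact hst.symm
  have himg : (fun t : ℝ => a ^ 2 / t) '' Set.Ioi 0 = Set.Ioi 0 := by
    ext t
    constructor
    · rintro ⟨s, hs, rfl⟩
      have hs : 0 < s := hs
      simp only [Set.mem_Ioi]
      positivity
    · intro ht
      have ht : 0 < t := ht
      refine ⟨a ^ 2 / t, by simp only [Set.mem_Ioi]; positivity, ?_⟩
      simp only
      field_simp
  have hflip : ∫ t in Set.Ioi (0 : ℝ), 1 / √t * Real.exp (-t - a ^ 2 / t) =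
      ∫ t in Set.Ioi (0 : ℝ), a / (t * √t) * Real.exp (-t - a ^ 2 / t) := by
    conv_lhs => rw [← himg]
    rw [integral_image_eq_integral_abs_deriv_smul measurableSet_Ioi hinv hinj]
    refine setIntegral_congr_fun measurableSet_Ioi fun t (ht : 0 < t) => ?_
    have hs : 0 < √t := Real.sqrt_pos.2 ht
    have h1 : √(a ^ 2 / t) = a / √t := by
      rw [Real.sqrt_div (sq_nonneg a), Real.sqrt_sq ha.le]
    have h2 : -(a ^ 2 / t) - a ^ 2 / (a ^ 2 / t) = -t - a ^ 2 / t := by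
      field_simp
      ring
    simp only [smul_eq_mul]
    rw [h1, h2, abs_neg, abs_of_pos (by positivity), ← mul_assoc]
    congr 1
    have h : √t ^ 2 = t := (Real.sq_sqrt ht.le)
    field_simp
    exact h
  have hI1 : IntegrableOn (fun t : ℝ => 1 / √t * Real.exp (-t - a ^ 2 / t)) (Set.Ioi 0) := by
    have h := Real.GammaIntegral_convergent (s := 1 / 2) (by norm_num)
    refine Integrable.mono' h (by fun_prop) ?_
    refine (ae_restrict_iff' measurableSet_Ioi).2 (ae_of_all _ fun t (ht : 0 < t) => ?_)
    rw [Real.norm_of_nonneg (by positivity), Real.sqrt_eq_rpow, one_div, ← Real.rpow_neg ht.le,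
      mul_comm]
    norm_num
    gcongr
    have : 0 ≤ a ^ 2 / t := by positivity
    linarith
  have hrew : ∀ t ∈ Set.Ioi (0 : ℝ), |1 / 2 * (1 / √t + a / (t * √t))| •
      Real.exp (-1 * glasserMap a t ^ 2) = Real.exp (2 * a) / 2 *
        (1 / √t * Real.exp (-t - a ^ 2 / t) + a / (t * √t) * Real.exp (-t - a ^ 2 / t)) := by
    intro t (ht : 0 < t)
    have hs : 0 < √t := Real.sqrt_pos.2 ht
    rw [abs_of_pos (by positivity), glasserMap_sq ht, smul_eq_mul,
      show -1 * (t + a ^ 2 / t - 2 * a) = 2 * a + (-t - a ^ 2 / t) by ring, Real.exp_add]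
    ring
  rw [setIntegral_congr_fun measurableSet_Ioi hrew] at hgauss
  rw [integrableOn_congr_fun hrew measurableSet_Ioi] at hint
  -- Integrability of the second term follows by subtracting the first from the transformed
  -- Gaussian.
  have hI2 : IntegrableOn (fun t : ℝ => a / (t * √t) * Real.exp (-t - a ^ 2 / t))
      (Set.Ioi 0) := by
    have h := (hint.const_mul (2 / Real.exp (2 * a))).sub hI1
    refine h.congr (ae_of_all _ fun t => ?_)
    have := Real.exp_pos (2 * a)
    simp only [Pi.sub_apply]
    field_simp
    ring
  rw [integral_const_mul, integral_add hI1 hI2, ← hflip] at hgauss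
  rw [← hgauss, mul_right_comm, div_mul_eq_mul_div, ← Real.exp_add]
  simp
  ring

/-- This is the multiplication formula `∫ Ĝ h = ∫ G ĥ` for a Gaussian `G`. -/
lemma integral_exp_neg_mul_sq_mul {h : EuclideanSpace ℝ (Fin d) → ℂ} (hh : Integrable h) {t : ℝ}
    (ht : 0 < t) :
    ∫ ξ, (Real.exp (-(t * ‖ξ‖ ^ 2)) : ℂ) * h ξ =
      ∫ y, (((Real.pi / t) ^ ((d : ℝ) / 2) * Real.exp (-Real.pi ^ 2 * ‖y‖ ^ 2 / t) : ℝ) : ℂ) *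
        𝓕 h y := by
  have hpi := Real.pi_pos
  -- With this `b` the transform of `exp(-b|v|²)` is a multiple of `exp(-t|w|²)`.
  set b : ℂ := ((Real.pi ^ 2 / t : ℝ) : ℂ) with hb
  have hbre : 0 < b.re := by rw [hb, Complex.ofReal_re]; positivity
  have hG : Integrable (fun v : EuclideanSpace ℝ (Fin d) => Complex.exp (-b * ‖v‖ ^ 2)) := by
    simpa using GaussianFourier.integrable_cexp_neg_mul_sq_norm_add hbre 0
      (0 : EuclideanSpace ℝ (Fin d))
  have key := VectorFourier.integral_fourierIntegral_smul_eq_flip (μ := volume) (ν := volume)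
    (L := innerₗ (EuclideanSpace ℝ (Fin d))) Real.continuous_fourierChar continuous_inner hG hh
  have hF : ∀ w : EuclideanSpace ℝ (Fin d), VectorFourier.fourierIntegral Real.fourierChar volume
      (innerₗ (EuclideanSpace ℝ (Fin d))) (fun v => Complex.exp (-b * ‖v‖ ^ 2)) w =
      (((t / Real.pi) ^ ((d : ℝ) / 2) * Real.exp (-(t * ‖w‖ ^ 2)) : ℝ) : ℂ) := by
    intro w
    have h1 := fourier_gaussian_innerProductSpace hbre w
    rw [finrank_euclideanSpace_fin] at h1
    refine h1.trans ?_
    rw [Complex.ofReal_mul, Complex.ofReal_cpow (by positivity), Complex.ofReal_exp]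
    congr 1
    · congr 1
      · rw [hb]
        push_cast
        field_simp
      · push_cast
        ring
    · congr 1
      rw [hb]
      push_cast
      field_simp
  have hFh : ∀ y, VectorFourier.fourierIntegral Real.fourierChar volume
      (innerₗ (EuclideanSpace ℝ (Fin d))).flip h y = 𝓕 h y := by
    intro y
    rw [flip_innerₗ]
    rfl
  simp only [hF, hFh, smul_eq_mul] at key
  have e1 : ∀ ξ, (Real.exp (-(t * ‖ξ‖ ^ 2)) : ℂ) * h ξ =
      (((Real.pi / t) ^ ((d : ℝ) / 2) : ℝ) : ℂ) *
      ((((t / Real.pi) ^ ((d : ℝ) / 2) * Real.exp (-(t * ‖ξ‖ ^ 2)) : ℝ) : ℂ) * h ξ) := by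
    intro ξ
    rw [← mul_assoc, ← Complex.ofReal_mul, ← mul_assoc, ← Real.mul_rpow (by positivity)
      (by positivity), div_mul_div_cancel₀ ht.ne', div_self hpi.ne', Real.one_rpow, one_mul]
  simp_rw [e1]
  rw [integral_const_mul, key, ← integral_const_mul]
  refine integral_congr_ae (ae_of_all _ fun y => ?_)
  simp only
  rw [hb, Complex.ofReal_mul, Complex.ofReal_exp, mul_assoc]
  congr 3
  push_cast
  ring

lemma fourier_fourierChar_smul (M : EuclideanSpace ℝ (Fin d) → ℂ) (x y : EuclideanSpace ℝ (Fin d)) :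
    𝓕 (fun ξ => Real.fourierChar (inner ℝ ξ x) • M ξ) y = 𝓕 M (y - x) := by
  rw [Real.fourier_eq, Real.fourier_eq]
  refine integral_congr_ae (ae_of_all _ fun ξ => ?_)
  simp only
  rw [smul_smul, ← AddChar.map_add_eq_mul, inner_sub_right]
  congr 2
  ring

/-- The inverse Fourier integral of `(1 + |ξ|²)^{-(d+1)/2} M(ξ)` is, up to a constant, the
convolution of `exp(-2π|y|)` with the Fourier transform of `M`. -/
lemma fourierInv_bessel_mul {M : EuclideanSpace ℝ (Fin d) → ℂ} {g : EuclideanSpace ℝ (Fin d) → ℝ}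
    (hM : Integrable M) (hg : Integrable g) (hMg : ∀ y, 𝓕 M y = g y)
    (x : EuclideanSpace ℝ (Fin d)) :
    𝓕⁻ (fun ξ : EuclideanSpace ℝ (Fin d) =>
        (((1 + ‖ξ‖ ^ 2) ^ (-((d : ℝ) + 1) / 2) : ℝ) : ℂ) * M ξ) x =
      ((Real.pi ^ ((d : ℝ) / 2) * √Real.pi / Real.Gamma (((d : ℝ) + 1) / 2) *
        ∫ y, g (y - x) * Real.exp (-2 * (Real.pi * ‖y‖)) : ℝ) : ℂ) := by
  have hpi := Real.pi_pos
  set s : ℝ := ((d : ℝ) + 1) / 2 with hs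
  have hs0 : 0 < s := by positivity
  have hGs : 0 < Real.Gamma s := Real.Gamma_pos_of_pos hs0
  -- Absorbing the character into `M` turns the inverse transform at `x` into a plain integral, at
  -- the price of translating `g`.
  set h : EuclideanSpace ℝ (Fin d) → ℂ := fun ξ => Real.fourierChar (inner ℝ ξ x) • M ξ with hh
  have hhint : Integrable h := by
    have := (Real.fourierIntegral_convergent_iff (μ := volume) (f := M) (-x)).2 hM
    simpa [hh] using this
  have hFh : ∀ y, 𝓕 h y = (g (y - x) : ℂ) := fun y => by
    rw [hh, fourier_fourierChar_smul, hMg]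
  have hgx : Integrable (fun y => g (y - x)) := hg.comp_sub_right x
  have hgam : IntegrableOn (fun t : ℝ => Real.exp (-t) * t ^ (s - 1)) (Set.Ioi 0) :=
    Real.GammaIntegral_convergent hs0
  have hhalf : IntegrableOn (fun t : ℝ => Real.exp (-t) * (1 / √t)) (Set.Ioi 0) := by
    refine (Real.GammaIntegral_convergent (s := 1 / 2) (by norm_num)).congr_fun
      (fun t (ht : 0 < t) => ?_) measurableSet_Ioi
    simp only
    rw [Real.sqrt_eq_rpow, one_div (t ^ (1 / 2 : ℝ)), ← Real.rpow_neg ht.le]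
    norm_num
  have hpos : ∀ᵐ p ∂((volume : Measure (EuclideanSpace ℝ (Fin d))).prod
      ((volume : Measure ℝ).restrict (Set.Ioi 0))), 0 < p.2 :=
    Measure.quasiMeasurePreserving_snd.ae (ae_restrict_mem measurableSet_Ioi)
  have hint1 : Integrable (Function.uncurry fun (ξ : EuclideanSpace ℝ (Fin d)) (t : ℝ) =>
      ((t ^ (s - 1) * Real.exp (-((1 + ‖ξ‖ ^ 2) * t)) : ℝ) : ℂ) * h ξ)
      (volume.prod (volume.restrict (Set.Ioi 0))) := by
    refine (hhint.norm.mul_prod hgam).mono' ?_ ?_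
    · refine AEStronglyMeasurable.mul (Measurable.aestronglyMeasurable (by fun_prop))
        hhint.aestronglyMeasurable.comp_fst
    · filter_upwards [hpos] with p hp
      simp only [Function.uncurry]
      rw [norm_mul, Complex.norm_real, Real.norm_of_nonneg (by positivity), mul_comm,
        mul_comm (p.2 ^ (s - 1))]
      gcongr
      nlinarith [sq_nonneg ‖p.1‖]
  have hint2 : Integrable (Function.uncurry fun (y : EuclideanSpace ℝ (Fin d)) (t : ℝ) =>
      Real.pi ^ ((d : ℝ) / 2) * (g (y - x) *
        (1 / √t * Real.exp (-t - (Real.pi * ‖y‖) ^ 2 / t))))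
      (volume.prod (volume.restrict (Set.Ioi 0))) := by
    refine Integrable.const_mul ?_ _
    refine (hgx.norm.mul_prod hhalf).mono' ?_ ?_
    · refine AEStronglyMeasurable.mul hgx.aestronglyMeasurable.comp_fst
        (Measurable.aestronglyMeasurable (by fun_prop))
    · filter_upwards [hpos] with p hp
      rw [norm_mul, Real.norm_of_nonneg (r := 1 / √p.2 * _) (by positivity)]
      rw [mul_comm (1 / √p.2)]
      gcongr
      have : 0 ≤ (Real.pi * ‖p.1‖) ^ 2 / p.2 := by positivity
      linarith
  -- The Gamma integral writes the Bessel factor as a superposition of Gaussians in `ξ`.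
  have step1 : (Real.Gamma s : ℂ) * 𝓕⁻ (fun ξ : EuclideanSpace ℝ (Fin d) =>
        (((1 + ‖ξ‖ ^ 2) ^ (-((d : ℝ) + 1) / 2) : ℝ) : ℂ) * M ξ) x =
      ∫ ξ, ∫ t in Set.Ioi (0 : ℝ),
        ((t ^ (s - 1) * Real.exp (-((1 + ‖ξ‖ ^ 2) * t)) : ℝ) : ℂ) * h ξ := by
    rw [Real.fourierInv_eq, ← integral_const_mul]
    refine integral_congr_ae (ae_of_all _ fun ξ => ?_)
    simp only
    have h1 : 0 < 1 + ‖ξ‖ ^ 2 := by positivity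
    rw [integral_mul_const, integral_complex_ofReal,
      Real.integral_rpow_mul_exp_neg_mul_Ioi hs0 h1, one_div, Real.inv_rpow h1.le,
      ← Real.rpow_neg h1.le, show -((d : ℝ) + 1) / 2 = -s by rw [hs]; ring, hh]
    simp only [Circle.smul_def, smul_eq_mul, Complex.ofReal_mul]
    ring
  have step2 : ∀ t ∈ Set.Ioi (0 : ℝ),
      ∫ ξ, ((t ^ (s - 1) * Real.exp (-((1 + ‖ξ‖ ^ 2) * t)) : ℝ) : ℂ) * h ξ =
      ((∫ y, Real.pi ^ ((d : ℝ) / 2) * (g (y - x) *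
        (1 / √t * Real.exp (-t - (Real.pi * ‖y‖) ^ 2 / t))) : ℝ) : ℂ) := by
    intro t (ht : 0 < t)
    have e1 : ∀ ξ, ((t ^ (s - 1) * Real.exp (-((1 + ‖ξ‖ ^ 2) * t)) : ℝ) : ℂ) * h ξ =
        ((t ^ (s - 1) * Real.exp (-t) : ℝ) : ℂ) * ((Real.exp (-(t * ‖ξ‖ ^ 2)) : ℂ) * h ξ) := by
      intro ξ
      rw [← mul_assoc, ← Complex.ofReal_mul, mul_assoc (t ^ (s - 1)), ← Real.exp_add]
      congr 4
      ring
    simp_rw [e1]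
    rw [integral_const_mul, integral_exp_neg_mul_sq_mul hhint ht, ← integral_const_mul,
      ← integral_complex_ofReal]
    refine integral_congr_ae (ae_of_all _ fun y => ?_)
    simp only
    rw [hFh, ← Complex.ofReal_mul, ← Complex.ofReal_mul]
    congr 1
    -- The order `s = (d+1)/2` is exactly the one for which the remaining power of `t` is
    -- `t^{-1/2}`, in every dimension.
    have e2 : t ^ (s - 1) * (Real.pi / t) ^ ((d : ℝ) / 2) =
        Real.pi ^ ((d : ℝ) / 2) * (1 / √t) := by
      rw [Real.div_rpow hpi.le ht.le, Real.sqrt_eq_rpow, one_div, ← Real.rpow_neg ht.le,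
        div_eq_mul_inv, ← Real.rpow_neg ht.le, mul_left_comm, ← Real.rpow_add ht]
      congr 2
      rw [hs]
      ring
    have e3 : Real.exp (-t) * Real.exp (-Real.pi ^ 2 * ‖y‖ ^ 2 / t) =
        Real.exp (-t - (Real.pi * ‖y‖) ^ 2 / t) := by
      rw [← Real.exp_add]
      congr 1
      ring
    rw [← e3]
    linear_combination (Real.exp (-t) * Real.exp (-Real.pi ^ 2 * ‖y‖ ^ 2 / t) * g (y - x)) * e2
  have step3 : (Real.Gamma s : ℂ) * 𝓕⁻ (fun ξ : EuclideanSpace ℝ (Fin d) =>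
        (((1 + ‖ξ‖ ^ 2) ^ (-((d : ℝ) + 1) / 2) : ℝ) : ℂ) * M ξ) x =
      ((Real.pi ^ ((d : ℝ) / 2) * √Real.pi *
        ∫ y, g (y - x) * Real.exp (-2 * (Real.pi * ‖y‖)) : ℝ) : ℂ) := by
    rw [step1, integral_integral_swap hint1, setIntegral_congr_fun measurableSet_Ioi step2,
      integral_complex_ofReal, ← integral_integral_swap hint2, ← integral_const_mul]
    congr 1
    refine integral_congr_ae (ae_of_all _ fun y => ?_)
    simp only
    rw [integral_const_mul, integral_const_mul,
      integral_inv_sqrt_mul_exp_neg_sub_div (by positivity)]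
    ring
  have hGc : (Real.Gamma s : ℂ) ≠ 0 := by exact_mod_cast hGs.ne'
  apply mul_left_cancel₀ hGc
  rw [step3, ← Complex.ofReal_mul]
  congr 1
  field_simp

/-! ### Windows -/

lemma exists_isWindow (d : ℕ) : ∃ m : EuclideanSpace ℝ (Fin d) → ℝ, IsWindow m := by
  -- Using `|ξ|²` rather than `|ξ|` keeps the bump smooth at the origin; the argument is nonpositive
  -- once `|ξ| ≥ 1/2`.
  set φ : EuclideanSpace ℝ (Fin d) → ℝ := fun ξ => Real.smoothTransition (1 - 4 * ‖ξ‖ ^ 2) with hφ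
  have hsm : ContDiff ℝ ∞ φ :=
    Real.smoothTransition.contDiff.comp (contDiff_const.sub (contDiff_const.mul (contDiff_norm_sq ℝ)))
  have hvan : ∀ ξ, 1 / 2 ≤ ‖ξ‖ → φ ξ = 0 := fun ξ hξ =>
    Real.smoothTransition.zero_of_nonpos (by nlinarith)
  have hcs : HasCompactSupport φ := by
    refine HasCompactSupport.intro (isCompact_closedBall 0 (1 / 2)) fun ξ hξ => hvan ξ ?_
    simp only [Metric.mem_closedBall, dist_zero_right, not_le] at hξ
    exact hξ.le
  have hpos : 0 < ∫ ξ, φ ξ ^ 2 := by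
    refine Continuous.integral_pos_of_hasCompactSupport_nonneg_nonzero (x := 0)
      (hsm.continuous.pow 2) ?_ (fun ξ => sq_nonneg _) ?_
    · exact hcs.comp_left (g := fun t : ℝ => t ^ 2) (by simp)
    · simp [hφ]
  set c := √(∫ ξ, φ ξ ^ 2)
  have hc : c ^ 2 = ∫ ξ, φ ξ ^ 2 := Real.sq_sqrt hpos.le
  refine ⟨fun ξ => c⁻¹ * φ ξ, contDiff_const.mul hsm, fun ξ η h => ?_, fun ξ hξ => ?_, ?_⟩
  · simp only [hφ, h]
  · simp only [hvan ξ hξ, mul_zero]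
  · simp_rw [mul_pow]
    rw [integral_const_mul, ← hc, inv_pow, inv_mul_cancel₀ (by rw [hc]; exact hpos.ne')]

namespace IsWindow

variable {m : EuclideanSpace ℝ (Fin d) → ℝ}

lemma hasCompactSupport (hm : IsWindow m) : HasCompactSupport m := by
  refine HasCompactSupport.intro (isCompact_closedBall 0 (1 / 2)) fun ξ hξ => hm.vanish ξ ?_
  simp only [Metric.mem_closedBall, dist_zero_right, not_le] at hξ
  exact hξ.le

lemma neg_eq (hm : IsWindow m) (ξ : EuclideanSpace ℝ (Fin d)) : m (-ξ) = m ξ :=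
  hm.radial _ _ (norm_neg ξ)

lemma integrable (hm : IsWindow m) : Integrable m :=
  hm.smooth.continuous.integrable_of_hasCompactSupport hm.hasCompactSupport

lemma contDiff_convolution (hm : IsWindow m) :
    ContDiff ℝ ∞ (m ⋆[ContinuousLinearMap.mul ℝ ℝ, volume] m) :=
  hm.hasCompactSupport.contDiff_convolution_right _ hm.integrable.locallyIntegrable hm.smooth

lemma hasCompactSupport_convolution (hm : IsWindow m) :
    HasCompactSupport (m ⋆[ContinuousLinearMap.mul ℝ ℝ, volume] m) :=
  HasCompactSupport.convolution _ hm.hasCompactSupport hm.hasCompactSupport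

lemma integrable_convolution (hm : IsWindow m) :
    Integrable (m ⋆[ContinuousLinearMap.mul ℝ ℝ, volume] m) :=
  hm.contDiff_convolution.continuous.integrable_of_hasCompactSupport
    hm.hasCompactSupport_convolution

lemma contDiff_kernelHat (hm : IsWindow m) : ContDiff ℝ ∞ (kernelHat m) := by
  refine ContDiff.mul ?_ hm.contDiff_convolution
  refine ContDiff.rpow_const_of_ne (contDiff_const.add (contDiff_norm_sq ℝ)) fun ξ => ?_
  positivity

lemma hasCompactSupport_kernelHat (hm : IsWindow m) : HasCompactSupport (kernelHat m) :=
  hm.hasCompactSupport_convolution.mul_left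

/-- If `|ξ| ≥ 1`, then `t` or `ξ - t` has norm at least `1/2`. This bounds the degree of the
smoothings. -/
lemma kernelHat_eq_zero (hm : IsWindow m) {ξ : EuclideanSpace ℝ (Fin d)} (hξ : 1 ≤ ‖ξ‖) :
    kernelHat m ξ = 0 := by
  rw [kernelHat, convolution_def, integral_eq_zero_of_ae, mul_zero]
  refine ae_of_all _ fun t => ?_
  simp only [ContinuousLinearMap.mul_apply', Pi.zero_apply]
  by_cases ht : 1 / 2 ≤ ‖t‖
  · rw [hm.vanish t ht, zero_mul]
  · have h : ‖ξ‖ ≤ ‖t‖ + ‖ξ - t‖ := by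
      simpa using norm_add_le t (ξ - t)
    rw [hm.vanish (ξ - t) (by linarith), mul_zero]

lemma kernelHat_zero (hm : IsWindow m) : kernelHat m 0 = 1 := by
  rw [kernelHat, convolution_def]
  simp only [ContinuousLinearMap.mul_apply', zero_sub, hm.neg_eq]
  simp only [← pow_two]
  rw [hm.norm_sq]
  simp

/-- The window as a complex-valued Schwartz function. -/
def toSchwartz (hm : IsWindow m) : SchwartzMap (EuclideanSpace ℝ (Fin d)) ℂ :=
  HasCompactSupport.toSchwartzMap (f := fun ξ => (m ξ : ℂ))
    (hm.hasCompactSupport.comp_left (g := ((↑) : ℝ → ℂ)) Complex.ofReal_zero)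
    (Complex.ofRealCLM.contDiff.comp hm.smooth)

/-- `K̂` as a complex-valued Schwartz function. -/
def kernelHatSchwartz (hm : IsWindow m) : SchwartzMap (EuclideanSpace ℝ (Fin d)) ℂ :=
  HasCompactSupport.toSchwartzMap (f := fun ξ => (kernelHat m ξ : ℂ))
    (hm.hasCompactSupport_kernelHat.comp_left (g := ((↑) : ℝ → ℂ)) Complex.ofReal_zero)
    (Complex.ofRealCLM.contDiff.comp hm.contDiff_kernelHat)

end IsWindow

/-- The Fourier transform of a real even function, as a real function. -/
def windowFourier (m : EuclideanSpace ℝ (Fin d) → ℝ) (y : EuclideanSpace ℝ (Fin d)) : ℝ :=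
  (𝓕 (fun ξ => (m ξ : ℂ)) y).re

/-! ### Positivity, radial symmetry, Harnack inequality and integrability of the kernel. -/

namespace IsWindow

variable {m : EuclideanSpace ℝ (Fin d) → ℝ}

/-- Conjugation reflects the real function `m`, which is even. Realness is what makes the square of
the transform nonnegative. -/
lemma fourier_eq_windowFourier (hm : IsWindow m) (y : EuclideanSpace ℝ (Fin d)) :
    𝓕 (fun ξ => (m ξ : ℂ)) y = windowFourier m y := by
  rw [windowFourier, eq_comm]
  refine Complex.conj_eq_iff_re.1 ?_
  rw [Real.fourier_eq, ← integral_conj, ← integral_neg_eq_self]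
  refine integral_congr_ae (ae_of_all _ fun ξ => ?_)
  simp only [hm.neg_eq, Circle.smul_def, smul_eq_mul, map_mul, Complex.conj_ofReal, inner_neg_left]
  rw [← Circle.coe_inv_eq_conj, ← AddChar.map_neg_eq_inv, neg_neg]

lemma windowFourier_comp_isometry (hm : IsWindow m)
    (L : EuclideanSpace ℝ (Fin d) ≃ₗᵢ[ℝ] EuclideanSpace ℝ (Fin d)) (y : EuclideanSpace ℝ (Fin d)) :
    windowFourier m (L y) = windowFourier m y := by
  rw [windowFourier, windowFourier, ← Real.fourier_comp_linearIsometry L]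
  refine congrArg (fun f : EuclideanSpace ℝ (Fin d) → ℂ => (𝓕 f y).re) (funext fun ξ => ?_)
  simp only [Function.comp]
  rw [hm.radial (L ξ) ξ (L.norm_map ξ)]

lemma continuous_windowFourier (hm : IsWindow m) : Continuous (windowFourier m) := by
  have h : Continuous (𝓕 hm.toSchwartz : SchwartzMap (EuclideanSpace ℝ (Fin d)) ℂ) := SchwartzMap.continuous _
  rw [SchwartzMap.fourier_coe] at h
  exact Complex.continuous_re.comp h

lemma integrable_windowFourier_sq (hm : IsWindow m) :
    Integrable (fun y => windowFourier m y ^ 2) := by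
  have h : MemLp (𝓕 hm.toSchwartz : SchwartzMap (EuclideanSpace ℝ (Fin d)) ℂ) 2 volume := SchwartzMap.memLp _ 2 volume
  rw [SchwartzMap.fourier_coe] at h
  exact h.re.integrable_sq

lemma fourier_convolution (hm : IsWindow m) (y : EuclideanSpace ℝ (Fin d)) :
    𝓕 (fun ξ => ((m ⋆[ContinuousLinearMap.mul ℝ ℝ, volume] m) ξ : ℂ)) y =
      ((windowFourier m y ^ 2 : ℝ) : ℂ) := by
  have h : (fun ξ => ((m ⋆[ContinuousLinearMap.mul ℝ ℝ, volume] m) ξ : ℂ)) =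
      (fun ξ => (m ξ : ℂ)) ⋆[ContinuousLinearMap.mul ℂ ℂ, volume] (fun ξ => (m ξ : ℂ)) := by
    ext ξ
    rw [convolution_def, convolution_def, ← integral_complex_ofReal]
    simp
  rw [h]
  refine (Real.fourier_mul_convolution_eq (R := ℂ) hm.integrable.ofReal hm.integrable.ofReal
    y).trans ?_
  have h' := hm.fourier_eq_windowFourier y
  rw [pow_two, Complex.ofReal_mul, ← h']
  rfl

/-- `K` is a positive multiple of the convolution of `exp(-2π|y|)` with the square of the Fourier
transform of the window. -/
lemma fourierInv_kernelHat (hm : IsWindow m) (x : EuclideanSpace ℝ (Fin d)) :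
    𝓕⁻ (fun ξ : EuclideanSpace ℝ (Fin d) => (kernelHat m ξ : ℂ)) x =
      ((Real.pi ^ ((d : ℝ) / 2) * √Real.pi / Real.Gamma (((d : ℝ) + 1) / 2) *
        ∫ y, windowFourier m y ^ 2 * Real.exp (-2 * (Real.pi * ‖y + x‖)) : ℝ) : ℂ) := by
  have h := fourierInv_bessel_mul hm.integrable_convolution.ofReal hm.integrable_windowFourier_sq
    hm.fourier_convolution x
  rw [← integral_add_right_eq_self _ x] at h
  simp only [add_sub_cancel_right] at h
  rw [← h]
  refine congrArg (fun f : EuclideanSpace ℝ (Fin d) → ℂ => 𝓕⁻ f x) (funext fun ξ => ?_)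
  rw [kernelHat, Complex.ofReal_mul]
  rfl

lemma ofReal_kernel (hm : IsWindow m) (x : EuclideanSpace ℝ (Fin d)) :
    (kernel m x : ℂ) = 𝓕⁻ (fun ξ : EuclideanSpace ℝ (Fin d) => (kernelHat m ξ : ℂ)) x := by
  rw [kernel, hm.fourierInv_kernelHat, Complex.ofReal_re]

lemma kernel_eq (hm : IsWindow m) (x : EuclideanSpace ℝ (Fin d)) :
    kernel m x = Real.pi ^ ((d : ℝ) / 2) * √Real.pi / Real.Gamma (((d : ℝ) + 1) / 2) *
        ∫ y, windowFourier m y ^ 2 * Real.exp (-2 * (Real.pi * ‖y + x‖)) := by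
  rw [kernel, hm.fourierInv_kernelHat, Complex.ofReal_re]

lemma besselConst_pos (d : ℕ) :
    0 < Real.pi ^ ((d : ℝ) / 2) * √Real.pi / Real.Gamma (((d : ℝ) + 1) / 2) := by
  have := Real.Gamma_pos_of_pos (s := ((d : ℝ) + 1) / 2) (by positivity)
  have := Real.pi_pos
  positivity

lemma kernel_nonneg (hm : IsWindow m) (x : EuclideanSpace ℝ (Fin d)) : 0 ≤ kernel m x := by
  rw [hm.kernel_eq]
  exact mul_nonneg (besselConst_pos d).le (integral_nonneg fun y => by positivity)

/-- Harnack inequality for `K`. -/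
lemma kernel_le_exp_mul (hm : IsWindow m) (x x' : EuclideanSpace ℝ (Fin d)) :
    kernel m x ≤ Real.exp (2 * Real.pi * ‖x - x'‖) * kernel m x' := by
  have hpi := Real.pi_pos
  have hint : ∀ x, Integrable fun y =>
      windowFourier m y ^ 2 * Real.exp (-2 * (Real.pi * ‖y + x‖)) := by
    intro x
    refine hm.integrable_windowFourier_sq.mono'
      ((hm.continuous_windowFourier.pow 2).mul (by fun_prop)).aestronglyMeasurable
      (ae_of_all _ fun y => ?_)
    rw [Real.norm_of_nonneg (by positivity)]
    refine mul_le_of_le_one_right (sq_nonneg _) (Real.exp_le_one_iff.2 ?_)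
    nlinarith [norm_nonneg (y + x)]
  rw [hm.kernel_eq, hm.kernel_eq, mul_left_comm]
  refine mul_le_mul_of_nonneg_left ?_ (besselConst_pos d).le
  rw [← integral_const_mul]
  refine integral_mono (hint x) ((hint x').const_mul _) fun y => ?_
  simp only
  rw [mul_left_comm (Real.exp _), ← Real.exp_add]
  gcongr
  -- The inequality already holds for the exponential under the integral, by the triangle
  -- inequality.
  have h : ‖y + x'‖ ≤ ‖y + x‖ + ‖x - x'‖ := by
    have := norm_sub_le (y + x) (x - x')
    rwa [show y + x - (x - x') = y + x' by abel] at this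
  nlinarith

/-- The reflection in the hyperplane orthogonal to `x - x'` maps `x` to `x'`, preserves volume and
leaves the transform of the window invariant. -/
lemma kernel_radial (hm : IsWindow m) {x x' : EuclideanSpace ℝ (Fin d)} (h : ‖x‖ = ‖x'‖) :
    kernel m x = kernel m x' := by
  set L := (ℝ ∙ (x - x'))ᗮ.reflection with hL
  have hx : L x = x' := Submodule.reflection_sub h
  rw [hm.kernel_eq, hm.kernel_eq]
  congr 1
  conv_rhs => rw [← (L.measurePreserving).integral_comp L.toHomeomorph.measurableEmbedding]
  refine integral_congr_ae (ae_of_all _ fun y => ?_)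
  simp only
  rw [hm.windowFourier_comp_isometry, ← hx, ← map_add L, L.norm_map]

lemma fourierInv_kernelHatSchwartz_apply (hm : IsWindow m) (x : EuclideanSpace ℝ (Fin d)) :
    (𝓕⁻ hm.kernelHatSchwartz : SchwartzMap (EuclideanSpace ℝ (Fin d)) ℂ) x = kernel m x := by
  rw [hm.ofReal_kernel, SchwartzMap.fourierInv_coe]
  rfl

lemma coe_fourierInv_kernelHatSchwartz (hm : IsWindow m) :
    ⇑(𝓕⁻ hm.kernelHatSchwartz : SchwartzMap (EuclideanSpace ℝ (Fin d)) ℂ) = fun x => (kernel m x : ℂ) :=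
  funext hm.fourierInv_kernelHatSchwartz_apply

lemma continuous_kernel (hm : IsWindow m) : Continuous (kernel m) := by
  have h := (𝓕⁻ hm.kernelHatSchwartz : SchwartzMap (EuclideanSpace ℝ (Fin d)) ℂ).continuous
  rw [hm.coe_fourierInv_kernelHatSchwartz] at h
  have h' := Complex.continuous_re.comp (f := fun x => (kernel m x : ℂ)) h
  simp only [Function.comp_def, Complex.ofReal_re] at h'
  exact h'

lemma integrable_pow_mul_kernel (hm : IsWindow m) (n : ℕ) :
    Integrable (fun y => ‖y‖ ^ n * kernel m y) := by
  have h := (𝓕⁻ hm.kernelHatSchwartz : SchwartzMap (EuclideanSpace ℝ (Fin d)) ℂ).integrable_pow_mul volume n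
  simp only [hm.fourierInv_kernelHatSchwartz_apply, Complex.norm_real,
    Real.norm_of_nonneg (hm.kernel_nonneg _)] at h
  exact h

lemma integrable_kernel (hm : IsWindow m) : Integrable (kernel m) := by
  simpa using hm.integrable_pow_mul_kernel 0

lemma fourier_kernel (hm : IsWindow m) (ξ : EuclideanSpace ℝ (Fin d)) :
    𝓕 (fun x => (kernel m x : ℂ)) ξ = kernelHat m ξ := by
  rw [← hm.coe_fourierInv_kernelHatSchwartz, ← SchwartzMap.fourier_coe,
    FourierTransform.fourier_fourierInv_eq]
  rfl

lemma integral_kernel (hm : IsWindow m) : ∫ x, kernel m x = 1 := by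
  have h := hm.fourier_kernel 0
  rw [Real.fourier_eq, hm.kernelHat_zero] at h
  simp only [inner_zero_right, neg_zero, AddChar.map_zero_eq_one, one_smul] at h
  rw [integral_complex_ofReal] at h
  exact_mod_cast h

/-- By Harnack a single zero would force `K = 0` everywhere, against total mass one. -/
lemma kernel_pos (hm : IsWindow m) (x : EuclideanSpace ℝ (Fin d)) : 0 < kernel m x := by
  refine (hm.kernel_nonneg x).lt_of_ne fun h => ?_
  have h0 : ∀ y, kernel m y = 0 := fun y =>
    le_antisymm (by simpa [← h] using hm.kernel_le_exp_mul y x) (hm.kernel_nonneg y)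
  simpa [h0] using hm.integral_kernel

lemma integral_unitBall_kernel_pos (hm : IsWindow m) :
    0 < ∫ y in {y : EuclideanSpace ℝ (Fin d) | ‖y‖ ≤ 1}, kernel m y := by
  have hset : {y : EuclideanSpace ℝ (Fin d) | ‖y‖ ≤ 1} = Metric.closedBall 0 1 := by
    ext; simp
  rw [hset, setIntegral_pos_iff_support_of_nonneg_ae (ae_of_all _ hm.kernel_nonneg)
    hm.integrable_kernel.integrableOn]
  have hs : Function.support (kernel m) = Set.univ :=
    Set.eq_univ_of_forall fun y => (hm.kernel_pos y).ne'
  rw [hs, Set.univ_inter]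
  exact Metric.measure_closedBall_pos _ _ one_pos

end IsWindow

/-! ### Tails of the kernel -/

/-- The mass of `K` outside the ball of radius `s`. -/
def tail (m : EuclideanSpace ℝ (Fin d) → ℝ) (s : ℝ≥0∞) : ℝ :=
  ∫ y in {y : EuclideanSpace ℝ (Fin d) | s ≤ ‖y‖ₑ}, kernel m y

lemma measurableSet_le_enorm (s : ℝ≥0∞) :
    MeasurableSet {y : EuclideanSpace ℝ (Fin d) | s ≤ ‖y‖ₑ} :=
  measurableSet_le measurable_const measurable_enorm

@[simp]
lemma tail_top (m : EuclideanSpace ℝ (Fin d) → ℝ) : tail m ⊤ = 0 := by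
  simp [tail]

namespace IsWindow

variable {m : EuclideanSpace ℝ (Fin d) → ℝ}

lemma tail_nonneg (hm : IsWindow m) (s : ℝ≥0∞) : 0 ≤ tail m s :=
  setIntegral_nonneg (measurableSet_le_enorm s) fun y _ => hm.kernel_nonneg y

lemma tail_anti (hm : IsWindow m) : Antitone (tail m) := fun _ _ hst =>
  setIntegral_mono_set hm.integrable_kernel.integrableOn (ae_of_all _ hm.kernel_nonneg)
    (Filter.Eventually.of_forall fun _ hy => hst.trans hy)

lemma tail_le_one (hm : IsWindow m) (s : ℝ≥0∞) : tail m s ≤ 1 := by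
  rw [← hm.integral_kernel]
  exact setIntegral_le_integral hm.integrable_kernel (ae_of_all _ hm.kernel_nonneg)

/-- Markov's inequality for the `n`-th moment of `K`, the source of the fast decay. -/
lemma pow_mul_tail_le (hm : IsWindow m) (n : ℕ) {s : ℝ} (hs : 0 ≤ s) :
    s ^ n * tail m (ENNReal.ofReal s) ≤ ∫ y, ‖y‖ ^ n * kernel m y := by
  rw [tail, ← integral_const_mul]
  refine (setIntegral_mono_on (hm.integrable_kernel.const_mul _).integrableOn
    (hm.integrable_pow_mul_kernel n).integrableOn (measurableSet_le_enorm _)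
    fun y hy => ?_).trans (setIntegral_le_integral (hm.integrable_pow_mul_kernel n)
      (ae_of_all _ fun y => mul_nonneg (by positivity) (hm.kernel_nonneg y)))
  have h : s ≤ ‖y‖ := by
    rw [Set.mem_ofPred_eq, ← ofReal_norm] at hy
    exact (ENNReal.ofReal_le_ofReal_iff (norm_nonneg y)).1 hy
  have := hm.kernel_nonneg y
  gcongr

/-- Tails at radii differing by one are comparable. -/
lemma tail_le_exp_mul_tail_add_one (hm : IsWindow m) (hd : 1 ≤ d) (s : ℝ≥0∞) :
    tail m s ≤ Real.exp (2 * Real.pi) * tail m (s + 1) := by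
  rcases eq_or_ne s ⊤ with rfl | hs
  · simp
  lift s to NNReal using hs
  -- The profile of the radial function `K` along a coordinate axis; `d ≥ 1` provides the axis. In
  -- polar coordinates both tails become integrals of `r^(d-1) k(r)` over half-lines.
  set k : ℝ → ℝ := fun r => kernel m (EuclideanSpace.single ⟨0, hd⟩ r) with hk
  have hkn : ∀ y, kernel m y = k ‖y‖ := fun y => hm.kernel_radial (by simp)
  have hk0 : ∀ r, 0 ≤ k r := fun r => hm.kernel_nonneg _
  have htail : ∀ ρ : NNReal, tail m ρ = ∫ y : EuclideanSpace ℝ (Fin d),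
      (Set.Ici (ρ : ℝ)).indicator k ‖y‖ := by
    intro ρ
    rw [tail, ← integral_indicator (measurableSet_le_enorm _)]
    refine integral_congr_ae (ae_of_all _ fun y => ?_)
    simp only [Set.indicator, Set.mem_ofPred_eq, Set.mem_Ici, hkn]
    have : (ρ : ℝ≥0∞) ≤ ‖y‖ₑ ↔ (ρ : ℝ) ≤ ‖y‖ := by
      rw [← enorm_norm, Real.enorm_eq_ofReal (norm_nonneg y), ENNReal.le_ofReal_iff_toReal_le
        ENNReal.coe_ne_top (norm_nonneg y), ENNReal.coe_toReal]
    simp only [this]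
  have : Nontrivial (EuclideanSpace ℝ (Fin d)) :=
    ⟨0, EuclideanSpace.single ⟨0, hd⟩ (1 : ℝ), fun h => by simpa using congrArg norm h⟩
  have hkint : IntegrableOn (fun r : ℝ => r ^ (d - 1) * k r) (Set.Ioi 0) := by
    have h := (integrable_fun_norm_addHaar (volume : Measure (EuclideanSpace ℝ (Fin d)))
      (f := k)).1 (hm.integrable_kernel.congr (ae_of_all _ hkn))
    simpa using h
  have hset : ∀ ρ : NNReal, ∫ r in Set.Ioi (0 : ℝ), r ^ (d - 1) • (Set.Ici (ρ : ℝ)).indicator k r =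
      ∫ r in Set.Ioi (ρ : ℝ), r ^ (d - 1) * k r := by
    intro ρ
    have e : ∀ r : ℝ, r ^ (d - 1) • (Set.Ici (ρ : ℝ)).indicator k r =
        (Set.Ici (ρ : ℝ)).indicator (fun r => r ^ (d - 1) * k r) r := by
      intro r
      by_cases hr : r ∈ Set.Ici (ρ : ℝ) <;> simp [hr]
    simp_rw [e]
    rw [← integral_Ici_eq_integral_Ioi, setIntegral_indicator measurableSet_Ici,
      Set.inter_eq_right.2 (Set.Ici_subset_Ici.2 (NNReal.coe_nonneg ρ)),
      integral_Ici_eq_integral_Ioi]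
  have h1 : ((s : ℝ≥0∞) + 1) = ((s + 1 : NNReal) : ℝ≥0∞) := by push_cast; rfl
  rw [h1, htail, htail, integral_fun_norm_addHaar, integral_fun_norm_addHaar,
    finrank_euclideanSpace_fin, hset, hset, nsmul_eq_mul, nsmul_eq_mul, smul_eq_mul, smul_eq_mul,
    mul_left_comm (Real.exp _), mul_left_comm (Real.exp _)]
  refine mul_le_mul_of_nonneg_left (mul_le_mul_of_nonneg_left ?_ (by positivity)) (by positivity)
  have hshift : ∫ r in Set.Ioi ((s + 1 : NNReal) : ℝ), r ^ (d - 1) * k r =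
      ∫ r in Set.Ioi (s : ℝ), (r + 1) ^ (d - 1) * k (r + 1) := by
    rw [← integral_indicator measurableSet_Ioi, ← integral_indicator measurableSet_Ioi,
      ← integral_add_right_eq_self (μ := volume) _ (1 : ℝ)]
    refine integral_congr_ae (ae_of_all _ fun r => ?_)
    simp [Set.indicator]
  have hkint' : IntegrableOn (fun r : ℝ => (r + 1) ^ (d - 1) * k (r + 1)) (Set.Ioi s) := by
    have h := (hkint.mono_set (Set.Ioi_subset_Ioi (NNReal.coe_nonneg (s + 1))))
    rw [← integrable_indicator_iff measurableSet_Ioi] at h ⊢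
    refine (h.comp_add_right 1).congr (ae_of_all _ fun r => ?_)
    simp [Set.indicator]
  rw [hshift, ← integral_const_mul]
  refine setIntegral_mono_on (hkint.mono_set (Set.Ioi_subset_Ioi s.2)) (hkint'.const_mul _)
    measurableSet_Ioi fun r (hr : (s : ℝ) < r) => ?_
  have hr0 : 0 ≤ r := s.2.trans hr.le
  have hh : k r ≤ Real.exp (2 * Real.pi) * k (r + 1) := by
    have := hm.kernel_le_exp_mul (EuclideanSpace.single ⟨0, hd⟩ r)
      (EuclideanSpace.single ⟨0, hd⟩ (r + 1))
    rwa [← dist_eq_norm, PiLp.dist_single_same, dist_self_add_right, norm_one,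
      mul_one] at this
  rw [mul_left_comm]
  -- After the shift by one, Harnack compares `k(r)` with `k(r + 1)`, and the weight `r^(d-1)` only
  -- grows.
  have := hk0 r
  gcongr
  linarith

end IsWindow

/-! ### The covering map of the torus -/

/-- The covering map `ℝ^d → ℝ^d / ℤ^d`. -/
def torusProj (y : EuclideanSpace ℝ (Fin d)) : UnitAddTorus (Fin d) := fun i => (y i : UnitAddCircle)

lemma isOpenQuotientMap_torusProj :
    IsOpenQuotientMap (torusProj : EuclideanSpace ℝ (Fin d) → UnitAddTorus (Fin d)) := by
  have h1 : IsOpenQuotientMap (Pi.map fun (_ : Fin d) (t : ℝ) => (t : UnitAddCircle)) :=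
    IsOpenQuotientMap.piMap fun _ => QuotientAddGroup.isOpenQuotientMap_mk
  exact h1.comp (PiLp.homeomorph 2 (fun _ : Fin d => ℝ)).isOpenQuotientMap

lemma continuous_torusProj :
    Continuous (torusProj : EuclideanSpace ℝ (Fin d) → UnitAddTorus (Fin d)) :=
  isOpenQuotientMap_torusProj.continuous

lemma torusProj_sub (x y : EuclideanSpace ℝ (Fin d)) :
    torusProj (x - y) = torusProj x - torusProj y := by
  ext i
  simp [torusProj]

lemma torusProj_zero : torusProj (0 : EuclideanSpace ℝ (Fin d)) = 0 := by
  ext i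
  simp [torusProj]

lemma volume_torus :
    (volume : Measure (UnitAddTorus (Fin d))) = Measure.pi fun _ => AddCircle.haarAddCircle := by
  rw [volume_pi]
  simp [AddCircle.volume_eq_smul_haarAddCircle]

instance : IsProbabilityMeasure (volume : Measure (UnitAddTorus (Fin d))) := by
  rw [volume_torus]
  infer_instance

/-- This allows functions that are only almost everywhere measurable, such as `chi Ω` for
null-measurable `Ω`, to be pulled back to `ℝ^d`. -/
lemma quasiMeasurePreserving_torusProj :
    Measure.QuasiMeasurePreserving
      (torusProj : EuclideanSpace ℝ (Fin d) → UnitAddTorus (Fin d)) volume volume := by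
  have hcube : ∀ a : Fin d → ℤ, MeasurePreserving
      (fun (y : Fin d → ℝ) (i : Fin d) => (y i : UnitAddCircle))
      (volume.restrict (Set.univ.pi fun i => Set.Ioc (a i : ℝ) (a i + 1))) volume := by
    intro a
    rw [volume_pi, Measure.restrict_pi_pi, volume_pi]
    exact measurePreserving_pi _ _ fun i => UnitAddCircle.measurePreserving_mk (a i : ℝ)
  have hpi : Measure.QuasiMeasurePreserving
      (fun (y : Fin d → ℝ) (i : Fin d) => (y i : UnitAddCircle)) volume volume := by
    refine ⟨(hcube 0).measurable, Measure.AbsolutelyContinuous.mk fun s hs hs0 => ?_⟩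
    rw [Measure.map_apply (hcube 0).measurable hs]
    -- Countably many unit cubes cover `ℝ^d`, and the projection preserves measure on each.
    have hcover : (⋃ a : Fin d → ℤ, Set.univ.pi fun i => Set.Ioc (a i : ℝ) (a i + 1)) =
        (Set.univ : Set (Fin d → ℝ)) := by
      refine Set.eq_univ_of_forall fun y => Set.mem_iUnion.2 ⟨fun i => ⌈y i⌉ - 1, ?_⟩
      intro i _
      have h1 := Int.ceil_lt_add_one (y i)
      have h2 := Int.le_ceil (y i)
      constructor <;> push_cast <;> linarith
    rw [← Set.inter_univ (_ ⁻¹' s), ← hcover, Set.inter_iUnion]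
    refine measure_iUnion_null fun a => ?_
    rw [← Measure.restrict_apply ((hcube 0).measurable hs), (hcube a).measure_preimage hs.nullMeasurableSet, hs0]
  exact hpi.comp (PiLp.volume_preserving_ofLp (Fin d)).quasiMeasurePreserving

lemma mFourier_torusProj (k : Fin d → ℤ) (y : EuclideanSpace ℝ (Fin d)) :
    UnitAddTorus.mFourier k (torusProj y) = (Real.fourierChar (inner ℝ y (latticeVec k)) : ℂ) := by
  simp only [UnitAddTorus.mFourier, ContinuousMap.coe_mk, torusProj, fourier_coe_apply,
    Real.fourierChar_apply]
  rw [← Complex.exp_sum]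
  congr 1
  simp only [latticeVec, PiLp.inner_apply, RCLike.inner_apply, conj_trivial]
  push_cast
  rw [Finset.mul_sum, Finset.sum_mul]
  refine Finset.sum_congr rfl fun i _ => ?_
  ring

lemma mFourier_add_apply (k : Fin d → ℤ) (x y : UnitAddTorus (Fin d)) :
    UnitAddTorus.mFourier k (x + y) = UnitAddTorus.mFourier k x * UnitAddTorus.mFourier k y := by
  simp only [UnitAddTorus.mFourier, ContinuousMap.coe_mk, Pi.add_apply, fourier_apply, smul_add,
    AddCircle.toCircle_add, Circle.coe_mul, Finset.prod_mul_distrib]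

lemma fourierCoeffReal_eq (f : UnitAddTorus (Fin d) → ℝ) (k : Fin d → ℤ) :
    fourierCoeffReal f k = ∫ x, UnitAddTorus.mFourier (-k) x * (f x : ℂ) := by
  rw [volume_torus]
  rfl

lemma norm_mFourier_apply (k : Fin d → ℤ) (x : UnitAddTorus (Fin d)) :
    ‖UnitAddTorus.mFourier k x‖ = 1 := by
  simp only [UnitAddTorus.mFourier, ContinuousMap.coe_mk, norm_prod, fourier_apply,
    Circle.norm_coe, Finset.prod_const_one]

lemma latticeVec_neg (k : Fin d → ℤ) : latticeVec (-k) = -latticeVec k := by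
  ext i
  simp [latticeVec]

/-! ### Smoothing by the rescaled kernel -/

/-- The convolution of `f` with the periodization of `R^d K(R ·)`. -/
def smoothing (m : EuclideanSpace ℝ (Fin d) → ℝ) (R : ℕ) (f : UnitAddTorus (Fin d) → ℝ)
    (x : UnitAddTorus (Fin d)) : ℝ :=
  ∫ y, kernel m y * f (x - torusProj ((R : ℝ)⁻¹ • y))

/-- A bounded measurable function. -/
structure IsBddMeas (f : UnitAddTorus (Fin d) → ℝ) : Prop where
  aestronglyMeasurable : AEStronglyMeasurable f volume
  bdd : ∃ C, ∀ x, |f x| ≤ C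

namespace IsBddMeas

variable {f g : UnitAddTorus (Fin d) → ℝ}

lemma add (hf : IsBddMeas f) (hg : IsBddMeas g) : IsBddMeas (fun x => f x + g x) := by
  obtain ⟨C, hC⟩ := hf.bdd
  obtain ⟨D, hD⟩ := hg.bdd
  exact ⟨hf.1.add hg.1, C + D, fun x => (abs_add_le _ _).trans (add_le_add (hC x) (hD x))⟩

lemma sub (hf : IsBddMeas f) (hg : IsBddMeas g) : IsBddMeas (fun x => f x - g x) := by
  obtain ⟨C, hC⟩ := hf.bdd
  obtain ⟨D, hD⟩ := hg.bdd
  exact ⟨hf.1.sub hg.1, C + D, fun x => (abs_sub _ _).trans (add_le_add (hC x) (hD x))⟩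

lemma integrable (hf : IsBddMeas f) : Integrable f volume := by
  obtain ⟨C, hC⟩ := hf.bdd
  exact Integrable.of_bound hf.1 C (ae_of_all _ hC)

lemma integrable_mFourier_mul (hf : IsBddMeas f) (k : Fin d → ℤ) :
    Integrable (fun x => UnitAddTorus.mFourier k x * (f x : ℂ)) volume := by
  refine hf.integrable.ofReal.bdd_mul (c := 1)
    (UnitAddTorus.mFourier k).continuous.aestronglyMeasurable (ae_of_all _ fun x => ?_)
  exact (norm_mFourier_apply k x).le

lemma fourierCoeffReal_add (hf : IsBddMeas f) (hg : IsBddMeas g) (k : Fin d → ℤ) :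
    fourierCoeffReal (fun x => f x + g x) k = fourierCoeffReal f k + fourierCoeffReal g k := by
  rw [fourierCoeffReal_eq, fourierCoeffReal_eq, fourierCoeffReal_eq,
    ← integral_add (hf.integrable_mFourier_mul _) (hg.integrable_mFourier_mul _)]
  simp only [Complex.ofReal_add, mul_add]

lemma fourierCoeffReal_sub (hf : IsBddMeas f) (hg : IsBddMeas g) (k : Fin d → ℤ) :
    fourierCoeffReal (fun x => f x - g x) k = fourierCoeffReal f k - fourierCoeffReal g k := by
  rw [fourierCoeffReal_eq, fourierCoeffReal_eq, fourierCoeffReal_eq,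
    ← integral_sub (hf.integrable_mFourier_mul _) (hg.integrable_mFourier_mul _)]
  simp only [Complex.ofReal_sub, mul_sub]

end IsBddMeas

lemma quasiMeasurePreserving_sub_torusProj_smul (x : UnitAddTorus (Fin d)) {c : ℝ} (hc : c ≠ 0) :
    Measure.QuasiMeasurePreserving
      (fun y : EuclideanSpace ℝ (Fin d) => x - torusProj (c • y)) volume volume := by
  have h1 : Measure.QuasiMeasurePreserving (fun y : EuclideanSpace ℝ (Fin d) => c • y)
      volume volume := by
    refine ⟨measurable_const_smul c, Measure.AbsolutelyContinuous.mk fun s hs hs0 => ?_⟩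
    rw [Measure.map_apply (measurable_const_smul c) hs, Measure.addHaar_preimage_smul _ hc, hs0,
      mul_zero]
  have h2 : Measure.QuasiMeasurePreserving (fun t : UnitAddTorus (Fin d) => x - t)
      volume volume := quasiMeasurePreserving_sub_left volume x
  exact h2.comp (quasiMeasurePreserving_torusProj.comp h1)

namespace IsWindow

variable {m : EuclideanSpace ℝ (Fin d) → ℝ} {f g : UnitAddTorus (Fin d) → ℝ} {R : ℕ}

lemma integrable_kernel_mul (hm : IsWindow m) (hR : 1 ≤ R) (hf : IsBddMeas f)
    (x : UnitAddTorus (Fin d)) :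
    Integrable (fun y => kernel m y * f (x - torusProj ((R : ℝ)⁻¹ • y))) := by
  obtain ⟨C, hC⟩ := hf.bdd
  have hc : (R : ℝ)⁻¹ ≠ 0 := by positivity
  exact hm.integrable_kernel.mul_bdd (c := C)
    (hf.1.comp_quasiMeasurePreserving (quasiMeasurePreserving_sub_torusProj_smul x hc))
    (ae_of_all _ fun y => hC _)

lemma smoothing_add (hm : IsWindow m) (hR : 1 ≤ R) (hf : IsBddMeas f) (hg : IsBddMeas g)
    (x : UnitAddTorus (Fin d)) :
    smoothing m R (fun x => f x + g x) x = smoothing m R f x + smoothing m R g x := by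
  rw [smoothing, smoothing, smoothing, ← integral_add (hm.integrable_kernel_mul hR hf x)
    (hm.integrable_kernel_mul hR hg x)]
  simp only [mul_add]

lemma smoothing_sub (hm : IsWindow m) (hR : 1 ≤ R) (hf : IsBddMeas f) (hg : IsBddMeas g)
    (x : UnitAddTorus (Fin d)) :
    smoothing m R (fun x => f x - g x) x = smoothing m R f x - smoothing m R g x := by
  rw [smoothing, smoothing, smoothing, ← integral_sub (hm.integrable_kernel_mul hR hf x)
    (hm.integrable_kernel_mul hR hg x)]
  simp only [mul_sub]

lemma continuous_smoothing (hm : IsWindow m) (hR : 1 ≤ R) (hf : IsBddMeas f) :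
    Continuous (smoothing m R f) := by
  obtain ⟨C, hC⟩ := hf.bdd
  have hR0 : (R : ℝ) ≠ 0 := by positivity
  rw [← isOpenQuotientMap_torusProj.continuous_comp_iff]
  -- As `f` need not be continuous, a change of variables on the cover moves the parameter into the
  -- kernel.
  have hshift : smoothing m R f ∘ torusProj = fun v : EuclideanSpace ℝ (Fin d) =>
      ∫ z, kernel m (z + (R : ℝ) • v) * f (0 - torusProj ((R : ℝ)⁻¹ • z)) := by
    ext v
    rw [Function.comp, smoothing, ← integral_add_right_eq_self _ ((R : ℝ) • v)]
    refine integral_congr_ae (ae_of_all _ fun z => ?_)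
    simp only
    congr 2
    rw [← torusProj_sub, smul_add, inv_smul_smul₀ hR0, ← torusProj_zero, ← torusProj_sub]
    congr 1
    abel
  rw [hshift, continuous_iff_continuousAt]
  intro v₀
  have hmeas : AEStronglyMeasurable (fun z : EuclideanSpace ℝ (Fin d) =>
      f (0 - torusProj ((R : ℝ)⁻¹ • z))) volume :=
    hf.1.comp_quasiMeasurePreserving
      (quasiMeasurePreserving_sub_torusProj_smul 0 (inv_ne_zero hR0))
  -- For `|v - v₀| < 1` Harnack bounds all the translated kernels by one multiple of the translate
  -- at `v₀`.
  refine continuousAt_of_dominated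
    (bound := fun z => Real.exp (2 * Real.pi * R) * kernel m (z + (R : ℝ) • v₀) * C)
    (Filter.Eventually.of_forall fun v => ?_) ?_ ?_ (ae_of_all _ fun z => ?_)
  · exact (hm.continuous_kernel.comp (by fun_prop)).aestronglyMeasurable.mul hmeas
  · filter_upwards [Metric.ball_mem_nhds v₀ one_pos] with v hv
    refine ae_of_all _ fun z => ?_
    rw [norm_mul, Real.norm_of_nonneg (hm.kernel_nonneg _)]
    have h1 := hm.kernel_le_exp_mul (z + (R : ℝ) • v) (z + (R : ℝ) • v₀)
    have h2 : ‖z + (R : ℝ) • v - (z + (R : ℝ) • v₀)‖ ≤ R := by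
      rw [add_sub_add_left_eq_sub, ← smul_sub, norm_smul, Real.norm_natCast, ← dist_eq_norm]
      exact mul_le_of_le_one_right (by positivity) (Metric.mem_ball.1 hv).le
    have h3 := hm.kernel_nonneg (z + (R : ℝ) • v₀)
    refine mul_le_mul (h1.trans ?_) (hC _) (norm_nonneg _) (by positivity)
    have := Real.pi_pos
    gcongr
  · exact (((hm.integrable_kernel.comp_add_right _).const_mul _).mul_const _)
  · exact ((hm.continuous_kernel.comp (by fun_prop)).mul continuous_const).continuousAt

lemma fourierCoeffReal_smoothing (hm : IsWindow m) (hf : IsBddMeas f)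
    (k : Fin d → ℤ) :
    fourierCoeffReal (smoothing m R f) k =
      (kernelHat m ((R : ℝ)⁻¹ • latticeVec k) : ℂ) * fourierCoeffReal f k := by
  obtain ⟨C, hC⟩ := hf.bdd
  set p : EuclideanSpace ℝ (Fin d) → UnitAddTorus (Fin d) :=
    fun y => torusProj ((R : ℝ)⁻¹ • y) with hp
  have hpc : Continuous p := continuous_torusProj.comp (continuous_const_smul _)
  -- The shear `(y, x) ↦ (y, x - p y)` preserves the product measure; this gives the joint
  -- measurability needed for Fubini.
  have hqmp : Measure.QuasiMeasurePreserving
      (fun q : UnitAddTorus (Fin d) × EuclideanSpace ℝ (Fin d) => q.1 - p q.2)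
      (volume.prod volume) volume := by
    have h1 : MeasurePreserving
        (fun q : EuclideanSpace ℝ (Fin d) × UnitAddTorus (Fin d) => (q.1, q.2 - p q.1))
        (volume.prod volume) (volume.prod volume) := by
      refine (MeasurePreserving.id volume).skew_product (g := fun y x => x - p y) ?_
        (ae_of_all _ fun y => (measurePreserving_sub_right volume (p y)).map_eq)
      exact (continuous_snd.sub (hpc.comp continuous_fst)).measurable
    exact (Measure.quasiMeasurePreserving_snd.comp h1.quasiMeasurePreserving).comp
      Measure.measurePreserving_swap.quasiMeasurePreserving
  have hint : Integrable (Function.uncurry fun (x : UnitAddTorus (Fin d))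
      (y : EuclideanSpace ℝ (Fin d)) =>
      UnitAddTorus.mFourier (-k) x * ((kernel m y * f (x - p y) : ℝ) : ℂ))
      (volume.prod volume) := by
    have hK : Integrable (fun q : UnitAddTorus (Fin d) × EuclideanSpace ℝ (Fin d) =>
        (C : ℝ) * kernel m q.2) (volume.prod volume) :=
      (integrable_const C).mul_prod hm.integrable_kernel
    refine hK.mono' ?_ (ae_of_all _ fun q => ?_)
    · refine AEStronglyMeasurable.mul
        ((UnitAddTorus.mFourier (-k)).continuous.comp continuous_fst).aestronglyMeasurable ?_
      refine Complex.continuous_ofReal.comp_aestronglyMeasurable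
        (AEStronglyMeasurable.mul ?_ (hf.1.comp_quasiMeasurePreserving hqmp))
      exact (hm.continuous_kernel.comp continuous_snd).aestronglyMeasurable
    · rw [Function.uncurry, norm_mul, norm_mFourier_apply, one_mul, Complex.norm_real, norm_mul,
        Real.norm_of_nonneg (hm.kernel_nonneg _), mul_comm]
      exact mul_le_mul_of_nonneg_right (hC _) (hm.kernel_nonneg _)
  have hinner : ∀ y, ∫ x, UnitAddTorus.mFourier (-k) x * ((kernel m y * f (x - p y) : ℝ) : ℂ) =
      (Real.fourierChar (-inner ℝ y ((R : ℝ)⁻¹ • latticeVec k)) • (kernel m y : ℂ)) *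
        fourierCoeffReal f k := by
    intro y
    rw [← integral_add_right_eq_self _ (p y), fourierCoeffReal_eq, ← integral_const_mul]
    refine integral_congr_ae (ae_of_all _ fun x => ?_)
    simp only
    rw [add_sub_cancel_right, mFourier_add_apply, hp, mFourier_torusProj, latticeVec_neg,
      inner_neg_right, inner_smul_left, inner_smul_right, Circle.smul_def, smul_eq_mul,
      conj_trivial, Complex.ofReal_mul]
    ring
  rw [fourierCoeffReal_eq]
  have houter : ∀ x, UnitAddTorus.mFourier (-k) x * (smoothing m R f x : ℂ) =
      ∫ y, UnitAddTorus.mFourier (-k) x * ((kernel m y * f (x - p y) : ℝ) : ℂ) := by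
    intro x
    rw [integral_const_mul, integral_complex_ofReal]
    rfl
  simp_rw [houter]
  rw [integral_integral_swap hint]
  simp_rw [hinner]
  rw [integral_mul_const, ← Real.fourier_eq, hm.fourier_kernel]

end IsWindow

/-! ### Trigonometric polynomials recognized by their Fourier coefficients. -/

lemma finite_norm_latticeVec_le (r : ℝ) : {k : Fin d → ℤ | ‖latticeVec k‖ ≤ r}.Finite := by
  refine (Set.Finite.pi' fun _ : Fin d => Set.finite_Icc (-⌈r⌉) ⌈r⌉).subset fun k hk i => ?_
  have h1 : |(k i : ℝ)| ≤ r := by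
    have := PiLp.norm_apply_le (latticeVec k) i
    rw [Real.norm_eq_abs] at this
    exact this.trans hk
  have h2 : |(k i : ℝ)| ≤ (⌈r⌉ : ℝ) := h1.trans (Int.le_ceil r)
  have h3 : |k i| ≤ ⌈r⌉ := by exact_mod_cast h2
  exact abs_le.1 h3

lemma isTrigPoly_const (R : ℕ) (a : ℝ) : IsTrigPoly R fun _ : UnitAddTorus (Fin d) => a := by
  refine ⟨Finsupp.single 0 (a : ℂ), fun k hk => ?_, fun x => ?_⟩
  · have hk0 : k = 0 := by
      simpa using Finsupp.support_single_subset hk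
    have h0 : latticeVec (0 : Fin d → ℤ) = 0 := by ext i; simp [latticeVec]
    rw [hk0, h0, norm_zero]
    positivity
  · rw [Finsupp.sum_single_index (by simp), UnitAddTorus.mFourier_zero]
    simp

/-- A continuous function whose Fourier coefficients of frequency beyond `R` vanish is a
trigonometric polynomial of degree at most `R`. -/
lemma isTrigPoly_of_fourierCoeffReal_eq_zero {R : ℕ} {f : UnitAddTorus (Fin d) → ℝ}
    (hf : Continuous f) (h : ∀ k, (R : ℝ) < ‖latticeVec k‖ → fourierCoeffReal f k = 0) :
    IsTrigPoly R f := by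
  classical
  set F : C(UnitAddTorus (Fin d), ℂ) := ⟨fun x => (f x : ℂ), by fun_prop⟩
  set S := (finite_norm_latticeVec_le (d := d) (R : ℝ)).toFinset with hS
  have hS0 : ∀ k ∉ S, UnitAddTorus.mFourierCoeff F k = 0 := by
    intro k hk
    refine h k (not_le.1 fun hle => hk ?_)
    rw [hS, Set.Finite.mem_toFinset]
    exact hle
  have hsum : Summable (UnitAddTorus.mFourierCoeff F) := summable_of_ne_finset_zero hS0
  refine ⟨Finsupp.onFinset S (UnitAddTorus.mFourierCoeff F)
    (fun k hk => by_contra fun hkS => hk (hS0 k hkS)), fun k hk => ?_, fun x => ?_⟩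
  · have := Finsupp.support_onFinset_subset hk
    rw [hS, Set.Finite.mem_toFinset] at this
    exact this
  · have h1 := UnitAddTorus.hasSum_mFourier_series_apply_of_summable hsum x
    have h2 : HasSum (fun i => UnitAddTorus.mFourierCoeff F i • UnitAddTorus.mFourier i x)
        (∑ i ∈ S, UnitAddTorus.mFourierCoeff F i • UnitAddTorus.mFourier i x) :=
      hasSum_sum_of_ne_finset_zero fun k hk => by rw [hS0 k hk, zero_smul]
    rw [Finsupp.onFinset_sum _ fun k => zero_mul _]
    exact h1.unique h2

lemma IsWindow.isTrigPoly_smoothing {m : EuclideanSpace ℝ (Fin d) → ℝ} {R : ℕ}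
    {f : UnitAddTorus (Fin d) → ℝ} (hm : IsWindow m) (hR : 1 ≤ R) (hf : IsBddMeas f) :
    IsTrigPoly R (smoothing m R f) := by
  refine isTrigPoly_of_fourierCoeffReal_eq_zero (hm.continuous_smoothing hR hf) fun k hk => ?_
  have hR0 : (0 : ℝ) < R := by positivity
  rw [hm.fourierCoeffReal_smoothing hf, hm.kernelHat_eq_zero, Complex.ofReal_zero, zero_mul]
  rw [norm_smul, norm_inv, Real.norm_natCast, ← div_eq_inv_mul, one_le_div hR0]
  exact hk.le

/-! ### Distance to a subset of the torus -/

lemma enorm_toLp_torusProj_le (y : EuclideanSpace ℝ (Fin d)) :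
    ‖(WithLp.toLp 2 (torusProj y) : PiLp 2 (fun _ : Fin d => UnitAddCircle))‖ₑ ≤ ‖y‖ₑ := by
  rw [← ofReal_norm, ← ofReal_norm]
  refine ENNReal.ofReal_le_ofReal ?_
  rw [PiLp.norm_eq_of_L2, EuclideanSpace.norm_eq]
  refine Real.sqrt_le_sqrt (Finset.sum_le_sum fun i _ => ?_)
  exact pow_le_pow_left₀ (norm_nonneg _) QuotientAddGroup.norm_mk_le_norm 2

lemma edist_toLp_sub_torusProj_le (x : UnitAddTorus (Fin d)) (y : EuclideanSpace ℝ (Fin d)) :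
    edist (WithLp.toLp 2 x : PiLp 2 (fun _ : Fin d => UnitAddCircle))
      (WithLp.toLp 2 (x - torusProj y)) ≤ ‖y‖ₑ := by
  rw [edist_eq_enorm_sub, ← WithLp.toLp_sub, sub_sub_cancel]
  exact enorm_toLp_torusProj_le y

lemma torusInfEDist_le_add (S : Set (UnitAddTorus (Fin d))) (x : UnitAddTorus (Fin d))
    (y : EuclideanSpace ℝ (Fin d)) :
    torusInfEDist x S ≤ torusInfEDist (x - torusProj y) S + ‖y‖ₑ :=
  Metric.infEDist_le_infEDist_add_edist.trans
    (add_le_add le_rfl (edist_toLp_sub_torusProj_le x y))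

lemma torusInfEDist_sub_le_add (S : Set (UnitAddTorus (Fin d))) (x : UnitAddTorus (Fin d))
    (y : EuclideanSpace ℝ (Fin d)) :
    torusInfEDist (x - torusProj y) S ≤ torusInfEDist x S + ‖y‖ₑ := by
  refine Metric.infEDist_le_infEDist_add_edist.trans (add_le_add le_rfl ?_)
  rw [edist_comm]
  exact edist_toLp_sub_torusProj_le x y

lemma continuous_torusInfEDist (S : Set (UnitAddTorus (Fin d))) :
    Continuous fun x => torusInfEDist x S :=
  Metric.continuous_infEDist.comp (PiLp.continuous_toLp 2 _)

lemma torusInfEDist_le_of_mem {S : Set (UnitAddTorus (Fin d))} {x : UnitAddTorus (Fin d)}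
    {y : EuclideanSpace ℝ (Fin d)} (h : x - torusProj y ∈ S) : torusInfEDist x S ≤ ‖y‖ₑ :=
  (Metric.infEDist_le_edist_of_mem (Set.mem_image_of_mem _ h)).trans
    (edist_toLp_sub_torusProj_le x y)

/-- A segment that joins a point of `Ω` to a point outside `Ω` meets the frontier of `Ω`. -/
lemma torusInfEDist_frontier_le {Ω : Set (UnitAddTorus (Fin d))} {x : UnitAddTorus (Fin d)}
    {y : EuclideanSpace ℝ (Fin d)} (h : ¬(x ∈ Ω ↔ x - torusProj y ∈ Ω)) :
    torusInfEDist x (frontier Ω) ≤ ‖y‖ₑ := by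
  set γ : ℝ → UnitAddTorus (Fin d) := fun t => x - torusProj (t • y) with hγ
  have hγc : Continuous γ :=
    continuous_const.sub (continuous_torusProj.comp (by fun_prop))
  have h0 : γ 0 = x := by simp [hγ, torusProj_zero]
  have h1 : γ 1 = x - torusProj y := by simp [hγ]
  have hpre : IsPreconnected (γ '' Set.Icc 0 1) :=
    isPreconnected_Icc.image _ hγc.continuousOn
  have hx : x ∈ γ '' Set.Icc 0 1 := ⟨0, by simp, h0⟩
  have hy : x - torusProj y ∈ γ '' Set.Icc 0 1 := ⟨1, by simp, h1⟩
  -- The connected segment is covered by the closed sets `closure Ω` and `closure Ωᶜ` and meets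
  -- both, so it meets their intersection, the frontier.
  have hmeet : (γ '' Set.Icc 0 1 ∩ (closure Ω ∩ closure Ωᶜ)).Nonempty := by
    refine isPreconnected_closed_iff.1 hpre _ _ isClosed_closure isClosed_closure ?_ ?_ ?_
    · intro z _
      by_cases hz : z ∈ Ω
      · exact Or.inl (subset_closure hz)
      · exact Or.inr (subset_closure hz)
    · by_cases hxΩ : x ∈ Ω
      · exact ⟨x, hx, subset_closure hxΩ⟩
      · exact ⟨_, hy, subset_closure (by tauto)⟩
    · by_cases hxΩ : x ∈ Ω
      · exact ⟨_, hy, subset_closure (show _ ∉ Ω by tauto)⟩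
      · exact ⟨x, hx, subset_closure hxΩ⟩
  obtain ⟨_, ⟨t, ht, rfl⟩, hz⟩ := hmeet
  rw [← frontier_eq_closure_inter_closure] at hz
  refine (torusInfEDist_le_of_mem hz).trans ?_
  rw [enorm_smul]
  refine mul_le_of_le_one_left (zero_le) ?_
  rw [Real.enorm_eq_ofReal ht.1]
  exact ENNReal.ofReal_le_one.2 ht.2

lemma natCast_mul_enorm_inv_smul {R : ℕ} (hR : 1 ≤ R) (y : EuclideanSpace ℝ (Fin d)) :
    (R : ℝ≥0∞) * ‖(R : ℝ)⁻¹ • y‖ₑ = ‖y‖ₑ := by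
  have hR0 : (R : ℝ) ≠ 0 := by positivity
  have h : (R : ℝ≥0∞) = ‖(R : ℝ)‖ₑ := by
    rw [Real.enorm_natCast]
  rw [h, ← enorm_smul, smul_inv_smul₀ hR0]

/-! ### The characteristic function and its majorant -/

lemma majorant_eq (m : EuclideanSpace ℝ (Fin d) → ℝ) (Ω : Set (UnitAddTorus (Fin d))) (R : ℕ)
    (x : UnitAddTorus (Fin d)) :
    majorant m Ω R x =
      Real.exp (2 * Real.pi) * (∫ y in {y : EuclideanSpace ℝ (Fin d) | ‖y‖ ≤ 1}, kernel m y)⁻¹ *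
        tail m (R * torusInfEDist x (frontier Ω)) := rfl

lemma isBddMeas_chi {Ω : Set (UnitAddTorus (Fin d))} (hΩ : NullMeasurableSet Ω volume) :
    IsBddMeas (chi Ω) := by
  refine ⟨?_, 1, fun x => ?_⟩
  · exact (aemeasurable_const.indicator₀ hΩ).aestronglyMeasurable
  · by_cases hx : x ∈ Ω <;> simp [chi, hx]

namespace IsWindow

variable {m : EuclideanSpace ℝ (Fin d) → ℝ} {Ω : Set (UnitAddTorus (Fin d))} {R : ℕ}

lemma majorantConst_pos (hm : IsWindow m) :
    0 < Real.exp (2 * Real.pi) *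
      (∫ y in {y : EuclideanSpace ℝ (Fin d) | ‖y‖ ≤ 1}, kernel m y)⁻¹ := by
  have := hm.integral_unitBall_kernel_pos
  positivity

lemma majorant_nonneg (hm : IsWindow m) (x : UnitAddTorus (Fin d)) : 0 ≤ majorant m Ω R x := by
  rw [majorant_eq]
  exact mul_nonneg hm.majorantConst_pos.le (hm.tail_nonneg _)

lemma isBddMeas_majorant (hm : IsWindow m) : IsBddMeas (majorant m Ω R) := by
  refine ⟨?_, Real.exp (2 * Real.pi) *
    (∫ y in {y : EuclideanSpace ℝ (Fin d) | ‖y‖ ≤ 1}, kernel m y)⁻¹ * 1, fun x => ?_⟩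
  · have h : Measurable (tail m) := hm.tail_anti.measurable
    exact ((h.comp ((continuous_torusInfEDist (frontier Ω)).measurable.const_mul
      (R : ℝ≥0∞))).const_mul _).aestronglyMeasurable
  · rw [abs_of_nonneg (hm.majorant_nonneg x), majorant_eq]
    exact mul_le_mul_of_nonneg_left (hm.tail_le_one _) hm.majorantConst_pos.le

/-- The error of the smoothing of a characteristic function is at most the tail of the kernel. -/
lemma abs_chi_sub_smoothing_le (hm : IsWindow m) (hΩ : NullMeasurableSet Ω volume) (hR : 1 ≤ R)
    (x : UnitAddTorus (Fin d)) :
    |chi Ω x - smoothing m R (chi Ω) x| ≤ tail m (R * torusInfEDist x (frontier Ω)) := by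
  have h1 : chi Ω x = ∫ y, kernel m y * chi Ω x := by
    rw [integral_mul_const, hm.integral_kernel, one_mul]
  rw [smoothing, tail, ← integral_indicator (measurableSet_le_enorm _)]
  nth_rewrite 1 [h1]
  rw [← integral_sub (hm.integrable_kernel.mul_const _)
    (hm.integrable_kernel_mul hR (isBddMeas_chi hΩ) x), ← Real.norm_eq_abs]
  refine norm_integral_le_of_norm_le
    (hm.integrable_kernel.indicator (measurableSet_le_enorm _)) (ae_of_all _ fun y => ?_)
  rw [← mul_sub, norm_mul, Real.norm_of_nonneg (hm.kernel_nonneg y)]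
  -- Only displacements that change membership in `Ω` contribute, and those satisfy `|y| ≥ R dist(x,
  -- ∂Ω)`.
  by_cases hiff : x ∈ Ω ↔ x - torusProj ((R : ℝ)⁻¹ • y) ∈ Ω
  · have h0 : chi Ω x - chi Ω (x - torusProj ((R : ℝ)⁻¹ • y)) = 0 := by
      by_cases hx : x ∈ Ω
      · simp [chi, hx, hiff.1 hx]
      · simp [chi, hx, hiff.not.1 hx]
    rw [h0, norm_zero, mul_zero]
    exact Set.indicator_nonneg (fun y _ => hm.kernel_nonneg y) y
  · have hmem : (R : ℝ≥0∞) * torusInfEDist x (frontier Ω) ≤ ‖y‖ₑ := by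
      rw [← natCast_mul_enorm_inv_smul hR y]
      exact mul_le_mul_right (torusInfEDist_frontier_le hiff) _
    rw [Set.indicator_of_mem (s := {y | _ ≤ ‖y‖ₑ}) hmem]
    refine mul_le_of_le_one_right (hm.kernel_nonneg y) ?_
    unfold chi
    by_cases hx : x ∈ Ω <;> by_cases hy : x - torusProj ((R : ℝ)⁻¹ • y) ∈ Ω <;> simp [hx, hy]

/-- Keep only `|y| ≤ 1` in the smoothing: there the scaled distance is at most `δ + 1`, so the
integral is at least `exp(2π) tail(δ + 1)`, the mass of the unit ball cancelling. -/
lemma tail_le_smoothing_majorant (hm : IsWindow m) (hd : 1 ≤ d) (hR : 1 ≤ R)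
    (x : UnitAddTorus (Fin d)) :
    tail m (R * torusInfEDist x (frontier Ω)) ≤ smoothing m R (majorant m Ω R) x := by
  have hI := hm.integral_unitBall_kernel_pos
  set I := ∫ y in {y : EuclideanSpace ℝ (Fin d) | ‖y‖ ≤ 1}, kernel m y with hIdef
  set δ : ℝ≥0∞ := R * torusInfEDist x (frontier Ω) with hδ
  have hball : MeasurableSet {y : EuclideanSpace ℝ (Fin d) | ‖y‖ ≤ 1} :=
    measurableSet_le measurable_norm measurable_const
  have hint := hm.integrable_kernel_mul hR (hm.isBddMeas_majorant (Ω := Ω) (R := R)) x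
  calc tail m δ ≤ Real.exp (2 * Real.pi) * tail m (δ + 1) :=
        hm.tail_le_exp_mul_tail_add_one hd δ
    _ = I * (Real.exp (2 * Real.pi) * I⁻¹ * tail m (δ + 1)) := by
        field_simp
    _ = ∫ y in {y : EuclideanSpace ℝ (Fin d) | ‖y‖ ≤ 1},
          kernel m y * (Real.exp (2 * Real.pi) * I⁻¹ * tail m (δ + 1)) := by
        rw [integral_mul_const]
    _ ≤ ∫ y in {y : EuclideanSpace ℝ (Fin d) | ‖y‖ ≤ 1},
          kernel m y * majorant m Ω R (x - torusProj ((R : ℝ)⁻¹ • y)) := by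
        refine setIntegral_mono_on (hm.integrable_kernel.mul_const _).integrableOn
          hint.integrableOn hball fun y hy => ?_
        refine mul_le_mul_of_nonneg_left ?_ (hm.kernel_nonneg y)
        rw [majorant_eq]
        refine mul_le_mul_of_nonneg_left (hm.tail_anti ?_) hm.majorantConst_pos.le
        calc (R : ℝ≥0∞) * torusInfEDist (x - torusProj ((R : ℝ)⁻¹ • y)) (frontier Ω)
            ≤ R * (torusInfEDist x (frontier Ω) + ‖(R : ℝ)⁻¹ • y‖ₑ) :=
              mul_le_mul_right (torusInfEDist_sub_le_add _ _ _) _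
          _ = δ + ‖y‖ₑ := by rw [mul_add, natCast_mul_enorm_inv_smul hR]
          _ ≤ δ + 1 := by
              gcongr
              rw [← ofReal_norm]
              exact ENNReal.ofReal_le_one.2 hy
    _ ≤ smoothing m R (majorant m Ω R) x :=
        setIntegral_le_integral hint
          (ae_of_all _ fun y => mul_nonneg (hm.kernel_nonneg y) (hm.majorant_nonneg _))

/-- Split at `|y| = δ/2`. Below it the scaled distance stays at least `δ/2`; beyond it the tail in
`majorant` is bounded by one and the mass of `K` is `tail(δ/2)`. Each part contributes one summand
of the factor two. -/
lemma smoothing_majorant_le (hm : IsWindow m) (hR : 1 ≤ R) (x : UnitAddTorus (Fin d)) :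
    smoothing m R (majorant m Ω R) x ≤
      2 * (Real.exp (2 * Real.pi) *
        (∫ y in {y : EuclideanSpace ℝ (Fin d) | ‖y‖ ≤ 1}, kernel m y)⁻¹) *
        tail m (R * torusInfEDist x (frontier Ω) / 2) := by
  have hC := hm.majorantConst_pos
  set C := Real.exp (2 * Real.pi) *
    (∫ y in {y : EuclideanSpace ℝ (Fin d) | ‖y‖ ≤ 1}, kernel m y)⁻¹ with hCdef
  set δ : ℝ≥0∞ := R * torusInfEDist x (frontier Ω) with hδ
  have hint := hm.integrable_kernel_mul hR (hm.isBddMeas_majorant (Ω := Ω) (R := R)) x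
  have hi1 : Integrable fun y => kernel m y * tail m (δ / 2) := hm.integrable_kernel.mul_const _
  have hi2 : Integrable ({y : EuclideanSpace ℝ (Fin d) | δ / 2 ≤ ‖y‖ₑ}.indicator (kernel m)) :=
    hm.integrable_kernel.indicator (measurableSet_le_enorm _)
  calc smoothing m R (majorant m Ω R) x
      ≤ ∫ y, C * (kernel m y * tail m (δ / 2) +
          {y : EuclideanSpace ℝ (Fin d) | δ / 2 ≤ ‖y‖ₑ}.indicator (kernel m) y) := by
        refine integral_mono hint ((hi1.add hi2).const_mul C) fun y => ?_
        simp only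
        rw [majorant_eq, ← hCdef, mul_left_comm]
        refine mul_le_mul_of_nonneg_left ?_ hC.le
        have hK := hm.kernel_nonneg y
        by_cases hy : δ / 2 ≤ ‖y‖ₑ
        · rw [Set.indicator_of_mem (s := {y | _ ≤ ‖y‖ₑ}) hy]
          have h1 := mul_le_of_le_one_right hK
            (hm.tail_le_one (R * torusInfEDist (x - torusProj ((R : ℝ)⁻¹ • y)) (frontier Ω)))
          have h2 := mul_nonneg hK (hm.tail_nonneg (δ / 2))
          linarith
        · rw [Set.indicator_of_notMem (s := {y | _ ≤ ‖y‖ₑ}) hy, add_zero]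
          refine mul_le_mul_of_nonneg_left (hm.tail_anti ?_) hK
          have h1 : δ ≤ R * torusInfEDist (x - torusProj ((R : ℝ)⁻¹ • y)) (frontier Ω) + ‖y‖ₑ := by
            rw [hδ, ← natCast_mul_enorm_inv_smul hR y, ← mul_add]
            exact mul_le_mul_right (torusInfEDist_le_add _ _ _) _
          by_contra hlt
          have h2 := ENNReal.add_lt_add (not_le.1 hlt) (not_le.1 hy)
          rw [ENNReal.add_halves] at h2
          exact absurd h1 (not_le.2 h2)
    _ = 2 * C * tail m (δ / 2) := by
        rw [integral_const_mul, integral_add hi1 hi2, integral_mul_const, hm.integral_kernel,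
          integral_indicator (measurableSet_le_enorm _), tail]
        ring

end IsWindow

/-! ### The decay function -/

/-- The function that controls the difference of majorant and minorant. -/
def decayFun (m : EuclideanSpace ℝ (Fin d) → ℝ) (t : ℝ) : ℝ :=
  4 * (Real.exp (2 * Real.pi) *
    (∫ y in {y : EuclideanSpace ℝ (Fin d) | ‖y‖ ≤ 1}, kernel m y)⁻¹) *
    tail m (ENNReal.ofReal (t / 2)) + Real.exp (-t)

namespace IsWindow

variable {m : EuclideanSpace ℝ (Fin d) → ℝ}

/-- The exponential term ensures positivity and makes the value at `0` at least one, as needed for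
`R = 0`. -/
lemma exp_neg_le_decayFun (hm : IsWindow m) (t : ℝ) : Real.exp (-t) ≤ decayFun m t := by
  have h1 := hm.majorantConst_pos
  have h2 := hm.tail_nonneg (ENNReal.ofReal (t / 2))
  exact le_add_of_nonneg_left (by positivity)

lemma posFastDecay_decayFun (hm : IsWindow m) : PosFastDecay (decayFun m) := by
  refine ⟨fun t _ => (Real.exp_pos _).trans_le (hm.exp_neg_le_decayFun t), fun α => ?_⟩
  have hC := hm.majorantConst_pos
  set C := Real.exp (2 * Real.pi) *
    (∫ y in {y : EuclideanSpace ℝ (Fin d) | ‖y‖ ≤ 1}, kernel m y)⁻¹ with hCdef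
  -- An integer exponent at least `α` suffices; for negative `α` it is `0`.
  set n := ⌈α⌉₊
  set M := ∫ y, ‖y‖ ^ n * kernel m y
  refine ⟨2 ^ n * (4 * C * (1 + 2 ^ n * M) + (1 + n.factorial)), fun t ht => ?_⟩
  have h1t : 0 < 1 + t := by linarith
  have hT1 := hm.tail_le_one (ENNReal.ofReal (t / 2))
  have hT0 := hm.tail_nonneg (ENNReal.ofReal (t / 2))
  set T := tail m (ENNReal.ofReal (t / 2)) with hT
  have hTn : t ^ n * T ≤ 2 ^ n * M := by
    have h := hm.pow_mul_tail_le n (s := t / 2) (by positivity)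
    rw [div_pow, div_mul_eq_mul_div, div_le_iff₀ (by positivity)] at h
    linarith
  have hE1 : Real.exp (-t) ≤ 1 := Real.exp_le_one_iff.2 (by linarith)
  have hEn : t ^ n * Real.exp (-t) ≤ n.factorial := by
    have h := Real.pow_div_factorial_le_exp t ht n
    rw [div_le_iff₀ (by positivity)] at h
    calc t ^ n * Real.exp (-t) ≤ Real.exp t * n.factorial * Real.exp (-t) := by gcongr
      _ = n.factorial := by rw [mul_right_comm, ← Real.exp_add]; simp
  have hpow : (1 + t) ^ n ≤ 2 ^ n * (1 + t ^ n) := by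
    have h := add_pow_le zero_le_one ht n
    rw [one_pow] at h
    refine h.trans ?_
    gcongr
    · norm_num
    · omega
  have hdec : decayFun m t * (1 + t) ^ n ≤
      2 ^ n * (4 * C * (1 + 2 ^ n * M) + (1 + n.factorial)) := by
    have h0 : 0 ≤ decayFun m t := (Real.exp_pos _).le.trans (hm.exp_neg_le_decayFun t)
    calc decayFun m t * (1 + t) ^ n ≤ decayFun m t * (2 ^ n * (1 + t ^ n)) := by gcongr
      _ = 2 ^ n * (4 * C * (T + t ^ n * T) +
            (Real.exp (-t) + t ^ n * Real.exp (-t))) := by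
          rw [decayFun, ← hCdef, ← hT]
          ring
      _ ≤ _ := by gcongr
  have hrpow : (1 + t) ^ (-(n : ℝ)) ≤ (1 + t) ^ (-α) :=
    Real.rpow_le_rpow_of_exponent_le (by linarith) (neg_le_neg (Nat.le_ceil α))
  have hcpos : 0 ≤ 2 ^ n * (4 * C * (1 + 2 ^ n * M) + (1 + (n.factorial : ℝ))) :=
    (mul_nonneg ((Real.exp_pos _).le.trans (hm.exp_neg_le_decayFun t)) (by positivity)).trans hdec
  calc decayFun m t ≤ 2 ^ n * (4 * C * (1 + 2 ^ n * M) + (1 + n.factorial)) / (1 + t) ^ n :=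
        (le_div_iff₀ (by positivity)).2 hdec
    _ = 2 ^ n * (4 * C * (1 + 2 ^ n * M) + (1 + n.factorial)) * (1 + t) ^ (-(n : ℝ)) := by
        rw [Real.rpow_neg h1t.le, Real.rpow_natCast, div_eq_mul_inv]
    _ ≤ _ := mul_le_mul_of_nonneg_left hrpow hcpos

lemma two_mul_smoothing_majorant_le_evalExt (hm : IsWindow m) {R : ℕ} (hR : 1 ≤ R)
    (Ω : Set (UnitAddTorus (Fin d))) (x : UnitAddTorus (Fin d)) :
    2 * smoothing m R (majorant m Ω R) x ≤
      evalExt (decayFun m) ((R : ℝ≥0∞) * torusInfEDist x (frontier Ω)) := by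
  have h := hm.smoothing_majorant_le (Ω := Ω) hR x
  rw [evalExt]
  split_ifs with htop
  -- At infinite distance the tail vanishes, matching the convention `ψ(∞) = 0`.
  · rw [htop, ENNReal.top_div_of_ne_top (by simp), tail_top, mul_zero] at h
    linarith
  · have he : ENNReal.ofReal (((R : ℝ≥0∞) * torusInfEDist x (frontier Ω)).toReal / 2) =
        (R : ℝ≥0∞) * torusInfEDist x (frontier Ω) / 2 := by
      rw [ENNReal.ofReal_div_of_pos two_pos, ENNReal.ofReal_toReal htop]
      simp
    rw [decayFun, he]
    have := Real.exp_pos (-((R : ℝ≥0∞) * torusInfEDist x (frontier Ω)).toReal)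
    linarith

end IsWindow

end TrigApprox

end

/-! ### Assembly of the minorant and the majorant. -/

theorem corollary2 (d : ℕ) (hd : 1 ≤ d) :
    (∃ m : EuclideanSpace ℝ (Fin d) → ℝ, TrigApprox.IsWindow m) ∧
    ∀ m : EuclideanSpace ℝ (Fin d) → ℝ, TrigApprox.IsWindow m →
      ∃ ψ : ℝ → ℝ, TrigApprox.PosFastDecay ψ ∧
        ∀ Ω : Set (UnitAddTorus (Fin d)), NullMeasurableSet Ω volume → ∀ R : ℕ,
          ∃ A B : UnitAddTorus (Fin d) → ℝ,
            TrigApprox.IsTrigPoly R A ∧ TrigApprox.IsTrigPoly R B ∧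
            (∀ x, A x ≤ TrigApprox.chi Ω x ∧ TrigApprox.chi Ω x ≤ B x) ∧
            (∀ x, |B x - A x| ≤
              TrigApprox.evalExt ψ ((R : ℝ≥0∞) * TrigApprox.torusInfEDist x (frontier Ω))) ∧
            (1 ≤ R → ∀ k : Fin d → ℤ,
              TrigApprox.fourierCoeffReal A k =
                (TrigApprox.kernelHat m ((R : ℝ)⁻¹ • TrigApprox.latticeVec k) : ℂ) *
                  (TrigApprox.fourierCoeffReal (TrigApprox.chi Ω) k -
                    TrigApprox.fourierCoeffReal (TrigApprox.majorant m Ω R) k) ∧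
              TrigApprox.fourierCoeffReal B k =
                (TrigApprox.kernelHat m ((R : ℝ)⁻¹ • TrigApprox.latticeVec k) : ℂ) *
                  (TrigApprox.fourierCoeffReal (TrigApprox.chi Ω) k +
                    TrigApprox.fourierCoeffReal (TrigApprox.majorant m Ω R) k)) := by
  refine ⟨TrigApprox.exists_isWindow d, fun m hm =>
    ⟨TrigApprox.decayFun m, hm.posFastDecay_decayFun, fun Ω hΩ R => ?_⟩⟩
  rcases Nat.eq_zero_or_pos R with rfl | hR
  -- For `R = 0` the constants `0` and `1` work: `0 · ∞ = 0`, so the bound is always `ψ(0) ≥ 1`.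
  · refine ⟨fun _ => 0, fun _ => 1, TrigApprox.isTrigPoly_const 0 0,
      TrigApprox.isTrigPoly_const 0 1, fun x => ?_, fun x => ?_, fun h => absurd h (by simp)⟩
    · by_cases hx : x ∈ Ω <;> simp [TrigApprox.chi, hx]
    · simpa [TrigApprox.evalExt] using hm.exp_neg_le_decayFun 0
  · have hχ := TrigApprox.isBddMeas_chi hΩ
    have hH := hm.isBddMeas_majorant (Ω := Ω) (R := R)
    have hA := hm.smoothing_sub hR hχ hH
    have hB := hm.smoothing_add hR hχ hH
    refine ⟨_, _, hm.isTrigPoly_smoothing hR (hχ.sub hH), hm.isTrigPoly_smoothing hR (hχ.add hH),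
      fun x => ?_, fun x => ?_, fun _ k => ?_⟩
    -- The smoothing error is at most the tail, which the smoothing of `H_R` dominates.
    · have h1 := abs_le.1 (hm.abs_chi_sub_smoothing_le hΩ hR x)
      have h2 := hm.tail_le_smoothing_majorant (Ω := Ω) hd hR x
      rw [hA, hB]
      constructor <;> linarith [h1.1, h1.2]
    · have h2 := (hm.tail_nonneg _).trans (hm.tail_le_smoothing_majorant (Ω := Ω) hd hR x)
      have h3 := hm.two_mul_smoothing_majorant_le_evalExt hR Ω x
      rw [hA, hB, add_sub_sub_cancel, ← two_mul, abs_of_nonneg (by positivity)]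
      exact h3
    · rw [hm.fourierCoeffReal_smoothing (hχ.sub hH), hm.fourierCoeffReal_smoothing (hχ.add hH),
        hχ.fourierCoeffReal_sub hH, hχ.fourierCoeffReal_add hH]
      exact ⟨rfl, rfl⟩
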